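/- Let $d\ge 1$ and let $\mathcal D\subset\mathbb R^d$ be a bounded Lipschitz domain (open, connected, non-empty, bounded, and locally near each boundary point, in suitable orthonormal coordinates, the strict epigraph of a Lipschitz function). Let $L^2(\partial\mathcal D)$ be taken with respect to surface measure, and put $$L^2_m(\partial\mathcal D)=\Big\{g\in L^2(\partial\mathcal D):\int_{\partial\mathcal D}g=0\Big\},\qquad H^1_m(\mathcal D)=\Big\{u\in H^1(\mathcal D):\int_{\partial\mathcal D}u=0\Big\}.$$ For $\alpha,\beta>0$ let $\mathcal S_{\alpha,\beta}$ be the set of symmetric matrices $M\in\mathbb R^{d\times d}$ with $\alpha|\xi|^2\le \xi^TM\xi$ and $|\xi^TM\eta|\le\beta|\xi||\eta|$ for all $\xi,\eta\in\mathbb R^d$. For $A\in L^\infty(\mathcal D,\mathcal S_{\alpha,\beta})$ and $g\in L^2_m(\partial\mathcal D)$ let $u(A,g)$ denote the weak solution in $H^1_m(\mathcal D)$ of $$-\operatorname{div}(A\nabla u)=0\ \text{ in }\mathcal D,\qquad (A\nabla u)\cdot n=g\ \text{ on }\partial\mathcal D,$$ that is, $\int_{\mathcal D}\nabla v^TA\nabla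 u=\int_{\partial\mathcal D}g\,v$ for all $v\in H^1(\mathcal D)$, and let $$\mathcal E(A,g)=\frac12\int_{\mathcal D}\nabla u(A,g)^TA\,\nabla u(A,g)-\int_{\partial\mathcal D}g\,u(A,g).$$ Let $(A_\varepsilon)_{\varepsilon>0}$ be a family with $A_\varepsilon\in L^\infty(\mathcal D,\mathcal S_{\alpha,\beta})$ for every $\varepsilon>0$. For a constant matrix $\overline A\in\mathcal S_{\alpha,\beta}$ define $$\Psi^{\mathrm{ME}}_\varepsilon(\overline A)=\sup_{g}\big|\mathcal E(A_\varepsilon,g)-\mathcal E(\overline A,g)\big|,\qquad \Psi^{\mathrm{MS}}_\varepsilon(\overline A)=\sup_{g}\big\|u(A_\varepsilon,g)-u(\overline A,g)\big\|_{L^2(\partial\mathcal D)},$$ both suprema being over $g\in L^2_m(\partial\mathcal D)$ with $\|g\|_{L^2(\partial\mathcal D)}=1$. Then, for every $\varepsilon>0$ and every $\overline A\in\mathcal S_{\alpha,\beta}$, the Neumann problems with coefficients $A_\varepsilon$ and $\overline A$ have, for each $g\in L^2_m(\partial\mathcal D)$, exactly one solution in $H^1_m(\mathcal D)$, both suprema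 are finite, and $$\Psi^{\mathrm{ME}}_\varepsilon(\overline A)=\tfrac12\,\Psi^{\mathrm{MS}}_\varepsilon(\overline A).$$ -/

import Mathlib

open MeasureTheory Filter Topology
open scoped ENNReal NNReal ContDiff Matrix InnerProductSpace

noncomputable section

namespace NeumannHom

/-- `ℝᵈ` with its Euclidean norm. -/
abbrev Rd (d : ℕ) : Type := EuclideanSpace ℝ (Fin d)

/-- A bounded Lipschitz domain: open, connected, non-empty, bounded, and, near every boundary
point, in suitable orthonormal coordinates, the strict epigraph of a Lipschitz function of the
coordinates in the hyperplane `eᗮ`. -/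
structure IsLipschitzDomain {d : ℕ} (D : Set (Rd d)) : Prop where
  isOpen : IsOpen D
  isConnected : IsConnected D
  isBounded : Bornology.IsBounded D
  lipschitz_boundary : ∀ x ∈ frontier D, ∃ (e : Rd d) (r : ℝ) (K : ℝ≥0)
    (h : ((Submodule.span ℝ {e})ᗮ : Submodule ℝ (Rd d)) → ℝ),
    ‖e‖ = 1 ∧ 0 < r ∧ LipschitzWith K h ∧
      ∀ y ∈ Metric.ball x r,
        y ∈ D ↔ h ((Submodule.span ℝ {e})ᗮ.orthogonalProjectionOnto y) < ⟪e, y⟫_ℝ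

/-- The surface measure on `∂D`: the `(d-1)`-dimensional Hausdorff measure, normalized so as to
agree with Lebesgue measure on hyperplanes, restricted to the topological boundary of `D`. -/
def surfaceMeasure {d : ℕ} (D : Set (Rd d)) : Measure (Rd d) :=
  (μHE[d - 1] : Measure (Rd d)).restrict (frontier D)

/-- `L²(D)`. -/
abbrev L2 {d : ℕ} (D : Set (Rd d)) : Type := Lp ℝ 2 (volume.restrict D)

/-- `L²(D; ℝᵈ)`. -/
abbrev L2Vec {d : ℕ} (D : Set (Rd d)) : Type := Lp (Rd d) 2 (volume.restrict D)

/-- `L²(∂D)`. -/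
abbrev L2Bdry {d : ℕ} (D : Set (Rd d)) : Type := Lp ℝ 2 (surfaceMeasure D)

/-- `L²_m(∂D)`, the elements of `L²(∂D)` of zero mean. -/
def L2BdryMean {d : ℕ} (D : Set (Rd d)) : Set (L2Bdry D) :=
  {g | ∫ x, g x ∂(surfaceMeasure D) = 0}

/-- `G` is the weak gradient of `u` in `D`. -/
def IsWeakGradient {d : ℕ} (D : Set (Rd d)) (u : Rd d → ℝ) (G : Rd d → Rd d) : Prop :=
  ∀ φ : Rd d → ℝ, ContDiff ℝ ∞ φ → HasCompactSupport φ → tsupport φ ⊆ D →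
    ∀ i : Fin d,
      ∫ x in D, u x * fderiv ℝ φ x (EuclideanSpace.single i 1) = - ∫ x in D, G x i * φ x

/-- The Sobolev space `H¹(D)`: functions in `L²(D)` with a weak gradient in `L²(D)`. -/
structure H1 {d : ℕ} (D : Set (Rd d)) where
  /-- the function -/
  fn : L2 D
  /-- its weak gradient -/
  grad : L2Vec D
  isWeakGradient : IsWeakGradient D fn grad

instance {d : ℕ} (D : Set (Rd d)) : Inhabited (H1 D) :=
  ⟨{ fn := 0
     grad := 0
     isWeakGradient := by
      intro φ _ _ _ i
      have h1 : ∫ x in D, (0 : L2 D) x * fderiv ℝ φ x (EuclideanSpace.single i 1) = 0 := by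
        refine integral_eq_zero_of_ae ?_
        filter_upwards [Lp.coeFn_zero ℝ 2 (volume.restrict D)] with x hx
        beta_reduce
        rw [hx]
        simp
      have h2 : ∫ x in D, (0 : L2Vec D) x i * φ x = 0 := by
        refine integral_eq_zero_of_ae ?_
        filter_upwards [Lp.coeFn_zero (Rd d) 2 (volume.restrict D)] with x hx
        beta_reduce
        rw [hx]
        simp
      rw [h1, h2, neg_zero] }⟩

/-- `γ ∈ L²(∂D)` is the trace of `u ∈ H¹(D)`: the limit in `L²(∂D)` of the restrictions to `∂D`
of functions, smooth up to the boundary, that converge to `u` in `H¹(D)`. -/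
def IsTrace {d : ℕ} {D : Set (Rd d)} (u : H1 D) (γ : L2Bdry D) : Prop :=
  ∃ φ : ℕ → Rd d → ℝ, (∀ n, ContDiff ℝ ∞ (φ n)) ∧
    Tendsto (fun n => eLpNorm (fun x => φ n x - u.fn x) 2 (volume.restrict D)) atTop (𝓝 0) ∧
    Tendsto (fun n => eLpNorm (fun x => gradient (φ n) x - u.grad x) 2 (volume.restrict D))
      atTop (𝓝 0) ∧
    Tendsto (fun n => eLpNorm (fun x => φ n x - γ x) 2 (surfaceMeasure D)) atTop (𝓝 0)

/-- `ξᵀ M η`. -/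
def bilin {d : ℕ} (M : Matrix (Fin d) (Fin d) ℝ) (ξ η : Rd d) : ℝ :=
  ξ.ofLp ⬝ᵥ (M *ᵥ η.ofLp)

/-- `S_{α,β}`: the symmetric, `α`-coercive, `β`-bounded matrices. -/
def coeffSet (d : ℕ) (α β : ℝ) : Set (Matrix (Fin d) (Fin d) ℝ) :=
  {M | M.IsSymm ∧ (∀ ξ : Rd d, α * ‖ξ‖ ^ 2 ≤ bilin M ξ ξ) ∧
    ∀ ξ η : Rd d, |bilin M ξ η| ≤ β * ‖ξ‖ * ‖η‖}

/-- `A ∈ L^∞(D, S_{α,β})`. -/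
def IsCoeffField {d : ℕ} (D : Set (Rd d)) (α β : ℝ)
    (A : Rd d → Matrix (Fin d) (Fin d) ℝ) : Prop :=
  (∀ i j, AEMeasurable (fun x => A x i j) (volume.restrict D)) ∧
    ∀ᵐ x ∂(volume.restrict D), A x ∈ coeffSet d α β

/-- `u`, with trace `γ`, is a solution in `H¹_m(D)` (zero mean on the boundary) of the variational
formulation of `-div (A ∇u) = 0` in `D`, `(A ∇u) · n = g` on `∂D`. -/
def IsSolution {d : ℕ} (D : Set (Rd d)) (A : Rd d → Matrix (Fin d) (Fin d) ℝ) (g : L2Bdry D)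
    (u : H1 D) (γ : L2Bdry D) : Prop :=
  IsTrace u γ ∧ ∫ x, γ x ∂(surfaceMeasure D) = 0 ∧
    ∀ (v : H1 D) (τ : L2Bdry D), IsTrace v τ →
      ∫ x in D, bilin (A x) (v.grad x) (u.grad x) = ∫ x, g x * τ x ∂(surfaceMeasure D)

/-- The Neumann problem with coefficient `A` has, for every `g ∈ L²_m(∂D)`, exactly one solution
in `H¹_m(D)`. -/
def IsWellPosed {d : ℕ} (D : Set (Rd d)) (A : Rd d → Matrix (Fin d) (Fin d) ℝ) : Prop :=
  ∀ g ∈ L2BdryMean D, ∃! p : H1 D × L2Bdry D, IsSolution D A g p.1 p.2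

/-- The solution `u(A, g)` of the Neumann problem, together with its trace on `∂D`. -/
def solution {d : ℕ} (D : Set (Rd d)) (A : Rd d → Matrix (Fin d) (Fin d) ℝ) (g : L2Bdry D) :
    H1 D × L2Bdry D :=
  Classical.epsilon fun p => IsSolution D A g p.1 p.2

/-- The stored energy `E(A, g) = ½ ∫_D ∇uᵀ A ∇u - ∫_{∂D} g u`, with `u = u(A, g)`. -/
def energy {d : ℕ} (D : Set (Rd d)) (A : Rd d → Matrix (Fin d) (Fin d) ℝ) (g : L2Bdry D) : ℝ :=
  (1 / 2) * (∫ x in D, bilin (A x) ((solution D A g).1.grad x) ((solution D A g).1.grad x))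
    - ∫ x, g x * (solution D A g).2 x ∂(surfaceMeasure D)

/-- The unit sphere of `L²_m(∂D)`. -/
def unitData {d : ℕ} (D : Set (Rd d)) : Set (L2Bdry D) :=
  {g | g ∈ L2BdryMean D ∧ ‖g‖ = 1}

/-- The values `|E(A, g) - E(B, g)|` over the unit sphere of `L²_m(∂D)`. -/
def valuesME {d : ℕ} (D : Set (Rd d)) (A B : Rd d → Matrix (Fin d) (Fin d) ℝ) : Set ℝ :=
  (fun g => |energy D A g - energy D B g|) '' unitData D

/-- The values `‖u(A, g) - u(B, g)‖_{L²(∂D)}` over the unit sphere of `L²_m(∂D)`. -/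
def valuesMS {d : ℕ} (D : Set (Rd d)) (A B : Rd d → Matrix (Fin d) (Fin d) ℝ) : Set ℝ :=
  (fun g => ‖(solution D A g).2 - (solution D B g).2‖) '' unitData D

/-- `Ψ^ME` for the oscillating coefficient `A` and the constant coefficient `Abar`. -/
def PsiME {d : ℕ} (D : Set (Rd d)) (A : Rd d → Matrix (Fin d) (Fin d) ℝ)
    (Abar : Matrix (Fin d) (Fin d) ℝ) : ℝ :=
  sSup (valuesME D A fun _ => Abar)

/-- `Ψ^MS` for the oscillating coefficient `A` and the constant coefficient `Abar`. -/
def PsiMS {d : ℕ} (D : Set (Rd d)) (A : Rd d → Matrix (Fin d) (Fin d) ℝ)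
    (Abar : Matrix (Fin d) (Fin d) ℝ) : ℝ :=
  sSup (valuesMS D A fun _ => Abar)

end NeumannHom

end

/-!
The map `N_A` taking `g ∈ L²_m(∂D)` to the trace of `u(A, g)` is bounded and symmetric, and testing
the variational formulation with `u(A, g)` itself gives `E(A, g) = -½ ⟪g, N_A g⟫`. Hence `Ψ^ME` is
half the numerical radius of the symmetric operator `N_A - N_B`, and `Ψ^MS` is its norm; the two
agree. Well-posedness is the Lax–Milgram theorem on `H¹_m(D)`, realized as a closed subspace of
`L²(D) × L²(D; ℝᵈ) × L²(∂D)`. Coercivity needs an estimate, modulo constants, of a smooth function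
on `D` and on `∂D` by its gradient: the Poincaré inequality on `D` is glued along overlaps from
balls and from translates of local epigraph pieces, and near a boundary point the trace is compared
with the averages over slices obtained by moving the graph in its transversal direction.
-/

noncomputable section

namespace NeumannHom

section LpSeminorm

variable {X Y F : Type*} [MeasurableSpace X] [MeasurableSpace Y] [NormedAddCommGroup F]
  {μ : Measure X} {ν : Measure Y} {p : ℝ≥0∞}

lemma eLpNorm_restrict_union_le (f : X → F) [Fact (1 ≤ p)] (hp : p ≠ ⊤) (s t : Set X) :
    eLpNorm f p (μ.restrict (s ∪ t)) ≤
      eLpNorm f p (μ.restrict s) + eLpNorm f p (μ.restrict t) := by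
  have hq : 1 ≤ p.toReal := (ENNReal.dichotomy p).resolve_left (by simp [hp])
  have hp0 : p ≠ 0 := (zero_lt_one.trans_le (Fact.out : 1 ≤ p)).ne'
  simp only [eLpNorm_eq_lintegral_rpow_enorm_toReal hp0 hp]
  calc (∫⁻ x in s ∪ t, ‖f x‖ₑ ^ p.toReal ∂μ) ^ (1 / p.toReal)
      ≤ ((∫⁻ x in s, ‖f x‖ₑ ^ p.toReal ∂μ) + ∫⁻ x in t, ‖f x‖ₑ ^ p.toReal ∂μ) ^
          (1 / p.toReal) := by
        gcongr
        exact lintegral_union_le _ s t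
    _ ≤ _ := ENNReal.rpow_add_le_add_rpow _ _ (by positivity)
        ((div_le_one (by linarith)).2 hq)

lemma eLpNorm_comp_restrict_le {f : Y → F} {T : X → Y} (hT : MeasurePreserving T μ ν)
    (hf : AEStronglyMeasurable f ν) {s : Set X} {t : Set Y} (ht : MeasurableSet t)
    (hst : Set.MapsTo T s t) :
    eLpNorm (f ∘ T) p (μ.restrict s) ≤ eLpNorm f p (ν.restrict t) := by
  rw [← eLpNorm_comp_measurePreserving hf.restrict (hT.restrict_preimage ht)]
  exact eLpNorm_mono_measure _ (Measure.restrict_mono hst le_rfl)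

lemma eLpNorm_comp_snd_prod [SFinite ν] {f : Y → F} (hf : AEStronglyMeasurable f ν)
    (hp : p ≠ ⊤) :
    eLpNorm (fun z : X × Y => f z.2) p (μ.prod ν) =
      μ Set.univ ^ (1 / p.toReal) * eLpNorm f p ν := by
  have hmap : (μ.prod ν).map Prod.snd = μ Set.univ • ν := Measure.map_snd_prod
  have h := eLpNorm_map_measure (p := p) (f := Prod.snd) (g := f) (μ := μ.prod ν)
    (hmap ▸ hf.smul_measure _) measurable_snd.aemeasurable
  rw [hmap, eLpNorm_smul_measure_of_ne_top hp] at h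
  simpa [Function.comp_def] using h.symm

variable [SFinite ν]

lemma eLpNorm_eLpNorm_prodMk {f : X × Y → F} (hf : AEStronglyMeasurable f (μ.prod ν))
    (hp : p ≠ 0) (hp' : p ≠ ⊤) :
    eLpNorm (fun x => eLpNorm (fun y => f (x, y)) p ν) p μ = eLpNorm f p (μ.prod ν) := by
  have hq := ENNReal.toReal_pos hp hp'
  simp only [eLpNorm_eq_lintegral_rpow_enorm_toReal hp hp', enorm_eq_self, ← ENNReal.rpow_mul,
    one_div, inv_mul_cancel₀ hq.ne', ENNReal.rpow_one]
  rw [lintegral_prod _ (hf.enorm.pow_const _)]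

lemma exists_mem_measure_mul_eLpNorm_prodMk_le {f : X × Y → F} {s : Set X}
    (hf : AEStronglyMeasurable f ((μ.restrict s).prod ν)) (hs : μ s ≠ 0) (hs' : μ s ≠ ⊤)
    (hp : p ≠ 0) (hp' : p ≠ ⊤) :
    ∃ x ∈ s, μ s ^ (1 / p.toReal) * eLpNorm (fun y => f (x, y)) p ν ≤
      eLpNorm f p ((μ.restrict s).prod ν) := by
  have hq := ENNReal.toReal_pos hp hp'
  have hm : AEMeasurable (fun x => ∫⁻ y, ‖f (x, y)‖ₑ ^ p.toReal ∂ν) (μ.restrict s) :=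
    (hf.enorm.pow_const _).lintegral_prod_right'
  obtain ⟨x, hx, hle⟩ := exists_le_setLAverage hs hs' hm
  refine ⟨x, hx, ?_⟩
  rw [setLAverage_eq, ENNReal.le_div_iff_mul_le (.inl hs) (.inl hs'),
    ← lintegral_prod _ (hf.enorm.pow_const _)] at hle
  simp only [eLpNorm_eq_lintegral_rpow_enorm_toReal hp hp']
  rw [← ENNReal.mul_rpow_of_nonneg _ _ (by positivity), mul_comm]
  gcongr

lemma eLpNorm_lintegral_enorm_le [IsFiniteMeasure μ] [Fact (1 ≤ p)] {f : X × Y → F}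
    (hf : AEStronglyMeasurable f (μ.prod ν)) (hp : p ≠ ⊤) :
    eLpNorm (fun y => ∫⁻ x, ‖f (x, y)‖ₑ ∂μ) p ν ≤
      μ Set.univ ^ (1 - 1 / p.toReal) * eLpNorm f p (μ.prod ν) := by
  have hp0 : p ≠ 0 := (zero_lt_one.trans_le (Fact.out : 1 ≤ p)).ne'
  have hswap := Measure.measurePreserving_swap (μ := ν) (ν := μ)
  have hfs : AEStronglyMeasurable (f ∘ Prod.swap) (ν.prod μ) := hf.comp_measurePreserving hswap
  have hholder : ∀ᵐ y ∂ν, ∫⁻ x, ‖f (x, y)‖ₑ ∂μ ≤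
      μ Set.univ ^ (1 - 1 / p.toReal) * eLpNorm (fun x => (f ∘ Prod.swap) (y, x)) p μ := by
    filter_upwards [hfs.prodMk_left] with y hy
    have h := eLpNorm_le_eLpNorm_mul_rpow_measure_univ (Fact.out : 1 ≤ p) hy
    rwa [eLpNorm_one_eq_lintegral_enorm, ENNReal.toReal_one, div_one, mul_comm] at h
  have hc : μ Set.univ ^ (1 - 1 / p.toReal) ≠ ⊤ := by
    have : 1 ≤ p.toReal := (ENNReal.dichotomy p).resolve_left (by simp [hp])
    exact ENNReal.rpow_ne_top_of_nonneg (sub_nonneg.2 ((div_le_one (by linarith)).2 this))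
      (measure_ne_top μ _)
  lift μ Set.univ ^ (1 - 1 / p.toReal) to ℝ≥0 using hc with c
  rw [← eLpNorm_comp_measurePreserving hf hswap, ← eLpNorm_eLpNorm_prodMk hfs hp0 hp]
  exact eLpNorm_le_mul_eLpNorm_of_ae_le_mul' hholder p

end LpSeminorm

section Segment

variable {E F : Type*} [NormedAddCommGroup E] [NormedSpace ℝ E] [NormedAddCommGroup F]
  [NormedSpace ℝ F]

lemma enorm_sub_le_lintegral_fderiv_segment {φ : E → F} (hφ : ContDiff ℝ 1 φ) (x v : E) {t σ : ℝ}
    (ht : 0 ≤ t) (htσ : t ≤ σ) :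
    ‖φ (x + t • v) - φ x‖ₑ ≤
      ‖v‖ₑ * ∫⁻ s in Set.Icc 0 σ, ‖fderiv ℝ φ (x + s • v)‖ₑ := by
  have hderiv (s : ℝ) : deriv (fun s : ℝ => φ (x + s • v)) s = fderiv ℝ φ (x + s • v) v := by
    have hline : HasDerivAt (fun s : ℝ => x + s • v) v s := by
      simpa using ((hasDerivAt_id s).smul_const v).const_add x
    exact ((hφ.differentiable one_ne_zero _).hasFDerivAt.comp_hasDerivAt s hline).deriv
  have hC1 : ContDiff ℝ 1 fun s : ℝ => φ (x + s • v) := by fun_prop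
  calc ‖φ (x + t • v) - φ x‖ₑ
      ≤ ∫⁻ s in Set.Icc 0 t, ‖fderiv ℝ φ (x + s • v) v‖ₑ := by
        simpa [hderiv] using enorm_sub_le_lintegral_deriv_of_contDiffOn_Icc hC1.contDiffOn ht
    _ ≤ ∫⁻ s in Set.Icc 0 σ, ‖v‖ₑ * ‖fderiv ℝ φ (x + s • v)‖ₑ := by
        refine (lintegral_mono_set (Set.Icc_subset_Icc_right htσ)).trans
          (lintegral_mono fun s => ?_)
        rw [mul_comm]
        exact ContinuousLinearMap.le_opENorm _ _
    _ = ‖v‖ₑ * ∫⁻ s in Set.Icc 0 σ, ‖fderiv ℝ φ (x + s • v)‖ₑ :=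
        lintegral_const_mul' _ _ enorm_ne_top

variable [MeasurableSpace E] [BorelSpace E] [SecondCountableTopology E]
  {Z : Type*} [MeasurableSpace Z] {ν : Measure Z} {p : ℝ≥0∞}

lemma eLpNorm_sub_le_eLpNorm_fderiv_segment [SFinite ν] [Fact (1 ≤ p)] (hp : p ≠ ⊤) {φ : E → F}
    (hφ : ContDiff ℝ 1 φ) {a v : Z → E} (ha : Measurable a) (hv : Measurable v) {R : ℝ≥0}
    (hR : ∀ᵐ z ∂ν, ‖v z‖ₑ ≤ R) {t σ : ℝ} (ht : 0 ≤ t) (htσ : t ≤ σ) :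
    eLpNorm (fun z => φ (a z + t • v z) - φ (a z)) p ν ≤
      R * (ENNReal.ofReal σ ^ (1 - 1 / p.toReal) *
        eLpNorm (fun q : ℝ × Z => fderiv ℝ φ (a q.2 + q.1 • v q.2)) p
          ((volume.restrict (Set.Icc 0 σ)).prod ν)) := by
  have hfderiv : AEStronglyMeasurable (fun q : ℝ × Z => fderiv ℝ φ (a q.2 + q.1 • v q.2))
      ((volume.restrict (Set.Icc 0 σ)).prod ν) :=
    ((hφ.continuous_fderiv one_ne_zero).stronglyMeasurable.comp_measurable
      (by fun_prop)).aestronglyMeasurable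
  have hpointwise : ∀ᵐ z ∂ν, ‖φ (a z + t • v z) - φ (a z)‖ₑ ≤
      R * ‖∫⁻ s in Set.Icc 0 σ, ‖fderiv ℝ φ (a z + s • v z)‖ₑ‖ₑ := by
    filter_upwards [hR] with z hz
    rw [enorm_eq_self]
    exact (enorm_sub_le_lintegral_fderiv_segment hφ _ _ ht htσ).trans (by gcongr)
  calc eLpNorm (fun z => φ (a z + t • v z) - φ (a z)) p ν
      ≤ R * eLpNorm (fun z => ∫⁻ s in Set.Icc 0 σ, ‖fderiv ℝ φ (a z + s • v z)‖ₑ) p ν :=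
        eLpNorm_le_mul_eLpNorm_of_ae_le_mul' hpointwise p
    _ ≤ _ := by
        gcongr
        simpa using eLpNorm_lintegral_enorm_le hfderiv hp

end Segment

section Translate

variable {E F : Type*} [NormedAddCommGroup E] [NormedSpace ℝ E] [NormedAddCommGroup F]
  [NormedSpace ℝ F] [MeasurableSpace E] [BorelSpace E] [SecondCountableTopology E]
  {μ : Measure E} [SFinite μ] [μ.IsAddLeftInvariant] {p : ℝ≥0∞} [Fact (1 ≤ p)]

lemma eLpNorm_translate_sub_le (hp : p ≠ ⊤) {φ : E → F} (hφ : ContDiff ℝ 1 φ) {S D : Set E}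
    (hD : MeasurableSet D) (w : E)
    (hS : ∀ x ∈ S, ∀ t ∈ Set.Icc (0 : ℝ) 1, x + t • w ∈ D) :
    eLpNorm (fun x => φ (x + w) - φ x) p (μ.restrict S) ≤
      ‖w‖ₑ * eLpNorm (fderiv ℝ φ) p (μ.restrict D) := by
  have hdφ : AEStronglyMeasurable (fderiv ℝ φ) μ :=
    (hφ.continuous_fderiv one_ne_zero).aestronglyMeasurable
  have hshear : MeasurePreserving (fun q : ℝ × E => (q.1, q.2 + q.1 • w))
      (volume.prod μ) (volume.prod μ) :=
    (MeasurePreserving.id volume).skew_product (by fun_prop)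
      (.of_forall fun s => map_add_right_eq_self μ (s • w))
  calc eLpNorm (fun x => φ (x + w) - φ x) p (μ.restrict S)
      ≤ ‖w‖ₑ * eLpNorm (fun q : ℝ × E => fderiv ℝ φ (q.2 + q.1 • w)) p
          ((volume.restrict (Set.Icc 0 1)).prod (μ.restrict S)) := by
        simpa [← enorm_eq_nnnorm] using eLpNorm_sub_le_eLpNorm_fderiv_segment (ν := μ.restrict S)
          hp hφ measurable_id measurable_const (R := ‖w‖₊) (.of_forall fun _ => le_rfl)
          zero_le_one le_rfl
    _ ≤ ‖w‖ₑ * eLpNorm (fun q : ℝ × E => fderiv ℝ φ q.2) p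
          ((volume.restrict (Set.Icc 0 1)).prod (μ.restrict D)) := by
        rw [Measure.prod_restrict, Measure.prod_restrict]
        gcongr
        exact eLpNorm_comp_restrict_le hshear hdφ.comp_snd (measurableSet_Icc.prod hD)
          fun q hq => ⟨hq.1, hS q.2 hq.2 q.1 hq.1⟩
    _ = ‖w‖ₑ * eLpNorm (fderiv ℝ φ) p (μ.restrict D) := by
        rw [eLpNorm_comp_snd_prod hdφ.restrict hp]
        simp

lemma eLpNorm_prod_sub_le_of_convex (hp : p ≠ ⊤) {φ : E → F} (hφ : ContDiff ℝ 1 φ) {U : Set E}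
    (hU : Convex ℝ U) (hUm : MeasurableSet U) {R : ℝ≥0} (hR : ∀ x ∈ U, ∀ y ∈ U, ‖y - x‖ ≤ R) :
    eLpNorm (fun q : E × E => φ q.2 - φ q.1) p ((μ.restrict U).prod (μ.restrict U)) ≤
      R * (μ (Metric.closedBall 0 R) ^ (1 / p.toReal) *
        eLpNorm (fderiv ℝ φ) p (μ.restrict U)) := by
  set W : Set E := Metric.closedBall 0 R
  set T : Set (E × E) := (fun q => (q.2, q.2 + q.1)) ⁻¹' (U ×ˢ U)
  have hdφ : AEStronglyMeasurable (fderiv ℝ φ) μ :=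
    (hφ.continuous_fderiv one_ne_zero).aestronglyMeasurable
  have hsub : AEStronglyMeasurable (fun q : E × E => φ q.2 - φ q.1) (μ.prod μ) :=
    (by fun_prop : Continuous fun q : E × E => φ q.2 - φ q.1).aestronglyMeasurable
  have hTm : MeasurableSet T := (hUm.prod hUm).preimage (by fun_prop)
  have hTW : ∀ q ∈ T, q.1 ∈ W := fun q hq => by
    simpa [W] using hR _ hq.1 _ hq.2
  have hTR : ∀ᵐ q ∂(μ.prod μ).restrict T, ‖q.1‖ₑ ≤ R := by
    filter_upwards [ae_restrict_mem hTm] with q hq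
    simpa [W, ← NNReal.coe_le_coe] using hTW q hq
  have hchange := (measurePreserving_prod_add_swap μ μ).restrict_preimage (hUm.prod hUm)
  have hshear : MeasurePreserving (fun q : ℝ × (E × E) => (q.1, (q.2.1, q.2.2 + q.1 • q.2.1)))
      (volume.prod (μ.prod μ)) (volume.prod (μ.prod μ)) :=
    (MeasurePreserving.id volume).skew_product (by fun_prop) (.of_forall fun s =>
      ((MeasurePreserving.id μ).skew_product (by fun_prop)
        (.of_forall fun w => map_add_right_eq_self μ (s • w))).map_eq)
  calc eLpNorm (fun q : E × E => φ q.2 - φ q.1) p ((μ.restrict U).prod (μ.restrict U))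
      = eLpNorm (fun q : E × E => φ (q.2 + q.1) - φ q.2) p ((μ.prod μ).restrict T) := by
        rw [Measure.prod_restrict, ← eLpNorm_comp_measurePreserving hsub.restrict hchange]
        rfl
    _ ≤ R * eLpNorm (fun q : ℝ × (E × E) => fderiv ℝ φ (q.2.2 + q.1 • q.2.1)) p
          ((volume.restrict (Set.Icc 0 1)).prod ((μ.prod μ).restrict T)) := by
        simpa using eLpNorm_sub_le_eLpNorm_fderiv_segment (ν := (μ.prod μ).restrict T) hp hφ
          measurable_snd measurable_fst hTR zero_le_one le_rfl
    _ ≤ R * eLpNorm (fun q : ℝ × (E × E) => fderiv ℝ φ q.2.2) p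
          ((volume.restrict (Set.Icc 0 1)).prod ((μ.restrict W).prod (μ.restrict U))) := by
        rw [Measure.prod_restrict, Measure.prod_restrict, Measure.prod_restrict]
        gcongr
        exact eLpNorm_comp_restrict_le hshear hdφ.comp_snd.comp_snd
          (measurableSet_Icc.prod (Metric.isClosed_closedBall.measurableSet.prod hUm))
          fun q hq => ⟨hq.1, hTW q.2 hq.2,
            hU.add_smul_mem hq.2.1 hq.2.2 hq.1⟩
    _ = R * (μ W ^ (1 / p.toReal) * eLpNorm (fderiv ℝ φ) p (μ.restrict U)) := by
        rw [eLpNorm_comp_snd_prod (f := fun z : E × E => fderiv ℝ φ z.2) hdφ.restrict.comp_snd hp,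
          eLpNorm_comp_snd_prod hdφ.restrict hp]
        simp

end Translate

section Constants

variable {X : Type*} [MeasurableSpace X] {μ : Measure X} {p : ℝ≥0∞} [Fact (1 ≤ p)] {f : X → ℝ}

lemma enorm_sub_mul_measure_rpow_le (hp : p ≠ ⊤) (hf : AEStronglyMeasurable f μ) (c c' : ℝ) :
    ‖c' - c‖ₑ * μ Set.univ ^ (1 / p.toReal) ≤
      eLpNorm (fun x => f x - c) p μ + eLpNorm (fun x => f x - c') p μ := by
  have hp0 : p ≠ 0 := (zero_lt_one.trans_le (Fact.out : 1 ≤ p)).ne'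
  calc ‖c' - c‖ₑ * μ Set.univ ^ (1 / p.toReal)
      = eLpNorm ((fun x => f x - c) - fun x => f x - c') p μ := by
        rw [← eLpNorm_const' _ hp0 hp]
        congr 1
        ext x
        simp
    _ ≤ eLpNorm (fun x => f x - c) p μ + eLpNorm (fun x => f x - c') p μ :=
        eLpNorm_sub_le (hf.sub aestronglyMeasurable_const) (hf.sub aestronglyMeasurable_const)
          Fact.out

lemma eLpNorm_sub_const_le (hp : p ≠ ⊤) (hf : AEStronglyMeasurable f μ) (c c' : ℝ) :
    eLpNorm (fun x => f x - c) p μ ≤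
      eLpNorm (fun x => f x - c') p μ + ‖c' - c‖ₑ * μ Set.univ ^ (1 / p.toReal) := by
  have hp0 : p ≠ 0 := (zero_lt_one.trans_le (Fact.out : 1 ≤ p)).ne'
  calc eLpNorm (fun x => f x - c) p μ
      = eLpNorm ((fun x => f x - c') + fun _ => c' - c) p μ := by
        congr 1
        ext x
        simp
    _ ≤ eLpNorm (fun x => f x - c') p μ + eLpNorm (fun _ => c' - c) p μ :=
        eLpNorm_add_le (hf.sub aestronglyMeasurable_const) aestronglyMeasurable_const Fact.out
    _ = _ := by rw [eLpNorm_const' _ hp0 hp]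

end Constants

section Poincare

variable {E : Type*} [NormedAddCommGroup E] [NormedSpace ℝ E] [MeasurableSpace E]

/-- A Poincaré inequality on `U` in the exponent `p`, up to an additive constant, with the gradient
measured on the possibly larger set `D`. The slack between `U` and `D` is what allows inequalities
on small pieces of `D` to be glued. -/
def HasPoincare (μ : Measure E) (p : ℝ≥0∞) (D U : Set E) : Prop :=
  ∃ C : ℝ≥0∞, C ≠ ⊤ ∧ ∀ φ : E → ℝ, ContDiff ℝ 1 φ → ∃ c : ℝ,
    eLpNorm (fun x => φ x - c) p (μ.restrict U) ≤ C * eLpNorm (fderiv ℝ φ) p (μ.restrict D)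

variable {μ : Measure E} {p : ℝ≥0∞} {D U V : Set E}

lemma HasPoincare.mono_left {D' : Set E} (h : HasPoincare μ p D U) (hD : D ⊆ D') :
    HasPoincare μ p D' U := by
  obtain ⟨C, hC, h⟩ := h
  refine ⟨C, hC, fun φ hφ => ?_⟩
  obtain ⟨c, hc⟩ := h φ hφ
  exact ⟨c, hc.trans (by gcongr)⟩

lemma HasPoincare.mono_right (h : HasPoincare μ p D V) (hUV : U ⊆ V) : HasPoincare μ p D U := by
  obtain ⟨C, hC, h⟩ := h
  refine ⟨C, hC, fun φ hφ => ?_⟩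
  obtain ⟨c, hc⟩ := h φ hφ
  exact ⟨c, (eLpNorm_mono_measure _ (Measure.restrict_mono hUV le_rfl)).trans hc⟩

variable [BorelSpace E] [Fact (1 ≤ p)]

lemma HasPoincare.union (hp : p ≠ ⊤) (hU : HasPoincare μ p D U) (hV : HasPoincare μ p D V)
    (hUV : μ (U ∩ V) ≠ 0) (hμV : μ V ≠ ⊤) : HasPoincare μ p D (U ∪ V) := by
  obtain ⟨C, hC, hU⟩ := hU
  obtain ⟨C', hC', hV⟩ := hV
  set m := μ (U ∩ V) ^ (1 / p.toReal)
  set M := μ V ^ (1 / p.toReal)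
  have hμUV : μ (U ∩ V) ≠ ⊤ := measure_ne_top_of_subset Set.inter_subset_right hμV
  have hm : m ≠ 0 := (ENNReal.rpow_pos hUV.bot_lt hμUV).ne'
  have hm' : m ≠ ⊤ := ENNReal.rpow_ne_top_of_nonneg (by positivity) hμUV
  have hM : M ≠ ⊤ := ENNReal.rpow_ne_top_of_nonneg (by positivity) hμV
  have hCm : (C + C') / m ≠ ⊤ := ENNReal.div_ne_top (by finiteness) hm
  refine ⟨C + (C' + (C + C') / m * M), by finiteness, fun φ hφ => ?_⟩
  obtain ⟨c, hc⟩ := hU φ hφ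
  obtain ⟨c', hc'⟩ := hV φ hφ
  set G := eLpNorm (fderiv ℝ φ) p (μ.restrict D)
  have hmeas (W : Set E) : AEStronglyMeasurable φ (μ.restrict W) :=
    hφ.continuous.aestronglyMeasurable
  have hcc : ‖c' - c‖ₑ ≤ (C + C') / m * G := by
    rw [← ENNReal.mul_div_right_comm, ENNReal.le_div_iff_mul_le (.inl hm) (.inl hm')]
    calc ‖c' - c‖ₑ * m
        ≤ eLpNorm (fun x => φ x - c) p (μ.restrict (U ∩ V)) +
            eLpNorm (fun x => φ x - c') p (μ.restrict (U ∩ V)) := by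
          simpa only [Measure.restrict_apply_univ] using
            enorm_sub_mul_measure_rpow_le hp (hmeas (U ∩ V)) c c'
      _ ≤ eLpNorm (fun x => φ x - c) p (μ.restrict U) +
            eLpNorm (fun x => φ x - c') p (μ.restrict V) := by
          gcongr
          exacts [Set.inter_subset_left, Set.inter_subset_right]
      _ ≤ C * G + C' * G := add_le_add hc hc'
      _ = (C + C') * G := by ring
  refine ⟨c, (eLpNorm_restrict_union_le _ hp U V).trans ?_⟩
  calc eLpNorm (fun x => φ x - c) p (μ.restrict U) + eLpNorm (fun x => φ x - c) p (μ.restrict V)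
      ≤ C * G + (C' * G + ‖c' - c‖ₑ * M) := by
        gcongr
        have h := eLpNorm_sub_const_le hp (hmeas V) c c'
        rw [Measure.restrict_apply_univ] at h
        exact h.trans (by gcongr)
    _ ≤ C * G + (C' * G + (C + C') / m * G * M) := by gcongr
    _ = (C + (C' + (C + C') / m * M)) * G := by ring

variable [SecondCountableTopology E] [SFinite μ] [μ.IsAddLeftInvariant]

lemma HasPoincare.of_translate (hp : p ≠ ⊤) (hU : HasPoincare μ p D U) (hUm : MeasurableSet U)
    (hD : MeasurableSet D) {S : Set E} (w : E) (hSU : ∀ x ∈ S, x + w ∈ U)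
    (hSD : ∀ x ∈ S, ∀ t ∈ Set.Icc (0 : ℝ) 1, x + t • w ∈ D) : HasPoincare μ p D S := by
  obtain ⟨C, hC, hU⟩ := hU
  refine ⟨C + ‖w‖ₑ, by finiteness, fun φ hφ => ?_⟩
  obtain ⟨c, hc⟩ := hU φ hφ
  refine ⟨c, ?_⟩
  have hφc : Continuous φ := hφ.continuous
  have hshift : eLpNorm (fun x => φ (x + w) - c) p (μ.restrict S) ≤
      eLpNorm (fun x => φ x - c) p (μ.restrict U) :=
    eLpNorm_comp_restrict_le (measurePreserving_add_right μ w)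
      (hφc.sub continuous_const).aestronglyMeasurable hUm hSU
  calc eLpNorm (fun x => φ x - c) p (μ.restrict S)
      = eLpNorm ((fun x => φ (x + w) - c) - fun x => φ (x + w) - φ x) p (μ.restrict S) := by
        congr 1
        ext x
        simp
    _ ≤ eLpNorm (fun x => φ (x + w) - c) p (μ.restrict S) +
          eLpNorm (fun x => φ (x + w) - φ x) p (μ.restrict S) :=
        eLpNorm_sub_le (by fun_prop) (by fun_prop) Fact.out
    _ ≤ C * eLpNorm (fderiv ℝ φ) p (μ.restrict D) + ‖w‖ₑ * eLpNorm (fderiv ℝ φ) p (μ.restrict D) :=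
        add_le_add (hshift.trans hc) (eLpNorm_translate_sub_le hp hφ hD w hSD)
    _ = (C + ‖w‖ₑ) * eLpNorm (fderiv ℝ φ) p (μ.restrict D) := by ring

lemma hasPoincare_of_convex (hp : p ≠ ⊤) [IsLocallyFiniteMeasure μ] [ProperSpace E]
    (hU : Convex ℝ U) (hUm : MeasurableSet U) (hUb : Bornology.IsBounded U) (hμU : μ U ≠ 0) :
    HasPoincare μ p U U := by
  have hp0 : p ≠ 0 := (zero_lt_one.trans_le (Fact.out : 1 ≤ p)).ne'
  have hμU' : μ U ≠ ⊤ := hUb.measure_lt_top.ne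
  set m := μ U ^ (1 / p.toReal)
  have hm : m ≠ 0 := (ENNReal.rpow_pos hμU.bot_lt hμU').ne'
  have hm' : m ≠ ⊤ := ENNReal.rpow_ne_top_of_nonneg (by positivity) hμU'
  set R : ℝ≥0 := ⟨Metric.diam U, Metric.diam_nonneg⟩
  have hR : ∀ x ∈ U, ∀ y ∈ U, ‖y - x‖ ≤ R := fun x hx y hy => by
    rw [← dist_eq_norm]
    exact Metric.dist_le_diam_of_mem hUb hy hx
  set B := μ (Metric.closedBall 0 R) ^ (1 / p.toReal)
  have hB : B ≠ ⊤ := ENNReal.rpow_ne_top_of_nonneg (by positivity) measure_closedBall_lt_top.ne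
  refine ⟨R * B / m, ENNReal.div_ne_top (by finiteness) hm, fun φ hφ => ?_⟩
  have hsub : Continuous fun q : E × E => φ q.2 - φ q.1 := by fun_prop
  obtain ⟨x, -, hx⟩ := exists_mem_measure_mul_eLpNorm_prodMk_le (ν := μ.restrict U)
    hsub.aestronglyMeasurable hμU hμU' hp0 hp
  refine ⟨φ x, ?_⟩
  rw [← ENNReal.mul_div_right_comm, ENNReal.le_div_iff_mul_le (.inl hm) (.inl hm'), mul_comm]
  exact hx.trans ((eLpNorm_prod_sub_le_of_convex hp hφ hU hUm hR).trans_eq (mul_assoc ..).symm)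

end Poincare

section Gluing

variable {E : Type*} [NormedAddCommGroup E] [NormedSpace ℝ E] [MeasurableSpace E]
  [BorelSpace E] {μ : Measure E} [μ.IsAddHaarMeasure] {p : ℝ≥0∞}
  [Fact (1 ≤ p)] {D : Set E}

lemma HasPoincare.union_of_mem_nhds (hp : p ≠ ⊤) {U V : Set E} (hU : HasPoincare μ p D U)
    (hV : HasPoincare μ p D V) (hμV : μ V ≠ ⊤) {x : E} (hUV : U ∩ V ∈ 𝓝 x) :
    HasPoincare μ p D (U ∪ V) :=
  hU.union hp hV (Measure.measure_pos_of_mem_nhds μ hUV).ne' hμV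

variable [FiniteDimensional ℝ E]

lemma hasPoincare_ball (hp : p ≠ ⊤) {x : E} {r : ℝ} (hr : 0 < r) (hD : Metric.ball x r ⊆ D) :
    HasPoincare μ p D (Metric.ball x r) :=
  (hasPoincare_of_convex hp (convex_ball x r) measurableSet_ball Metric.isBounded_ball
    (Metric.measure_ball_pos μ x hr).ne').mono_left hD

lemma exists_hasPoincare_mem_nhds (hp : p ≠ ⊤) (hD : IsOpen D) (hDc : IsPreconnected D) {x y : E}
    (hx : x ∈ D) (hy : y ∈ D) :
    ∃ U ∈ 𝓝 x, U ∈ 𝓝 y ∧ μ U ≠ ⊤ ∧ HasPoincare μ p D U := by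
  refine hDc.induction₂ (fun x y => ∃ U ∈ 𝓝 x, U ∈ 𝓝 y ∧ μ U ≠ ⊤ ∧ HasPoincare μ p D U)
    ?_ ?_ ?_ hx hy
  · intro x hx
    obtain ⟨r, hr, hrD⟩ := Metric.isOpen_iff.1 hD x hx
    filter_upwards [mem_nhdsWithin_of_mem_nhds (Metric.ball_mem_nhds x hr)] with y hy
    exact ⟨_, Metric.ball_mem_nhds x hr, Metric.isOpen_ball.mem_nhds hy, measure_ball_lt_top.ne,
      hasPoincare_ball hp hr hrD⟩
  · rintro x y z - - - ⟨U, hUx, hUy, hμU, hU⟩ ⟨V, hVy, hVz, hμV, hV⟩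
    exact ⟨U ∪ V, mem_of_superset hUx Set.subset_union_left,
      mem_of_superset hVz Set.subset_union_right, measure_union_ne_top hμU hμV,
      hU.union_of_mem_nhds hp hV hμV (inter_mem hUy hVy)⟩
  · rintro x y - - ⟨U, hUx, hUy, hU⟩
    exact ⟨U, hUy, hUx, hU⟩

lemma hasPoincare_of_forall_frontier (hp : p ≠ ⊤) (hD : IsOpen D) (hDc : IsConnected D)
    (hDb : Bornology.IsBounded D)
    (hloc : ∀ x ∈ frontier D, ∃ N ∈ 𝓝 x, HasPoincare μ p D (D ∩ N)) : HasPoincare μ p D D := by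
  have hμD : μ D ≠ ⊤ := hDb.measure_lt_top.ne
  have hloc' : ∀ x ∈ closure D, ∃ N ∈ 𝓝 x, HasPoincare μ p D (D ∩ N) := by
    intro x hx
    by_cases hxD : x ∈ D
    · obtain ⟨r, hr, hrD⟩ := Metric.isOpen_iff.1 hD x hxD
      exact ⟨_, Metric.ball_mem_nhds x hr,
        (hasPoincare_ball hp hr hrD).mono_right Set.inter_subset_right⟩
    · exact hloc x (hD.frontier_eq ▸ ⟨hx, hxD⟩)
  obtain ⟨x₀, hx₀⟩ := hDc.nonempty
  obtain ⟨r, hr, hrD⟩ := Metric.isOpen_iff.1 hD x₀ hx₀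
  obtain ⟨U, -, -, hDU, hU⟩ : ∃ U ∈ 𝓝 x₀, μ U ≠ ⊤ ∧ D ∩ closure D ⊆ U ∧ HasPoincare μ p D U := by
    refine hDb.isCompact_closure.induction_on
      (p := fun S => ∃ U ∈ 𝓝 x₀, μ U ≠ ⊤ ∧ D ∩ S ⊆ U ∧ HasPoincare μ p D U) ?_ ?_ ?_ ?_
    · exact ⟨_, Metric.ball_mem_nhds x₀ hr, measure_ball_lt_top.ne, by simp,
        hasPoincare_ball hp hr hrD⟩
    · rintro S T hST ⟨U, hUx, hμU, hTU, hU⟩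
      exact ⟨U, hUx, hμU, (Set.inter_subset_inter_right D hST).trans hTU, hU⟩
    · rintro S T ⟨U, hUx, hμU, hSU, hU⟩ ⟨V, hVx, hμV, hTV, hV⟩
      exact ⟨U ∪ V, mem_of_superset hUx Set.subset_union_left, measure_union_ne_top hμU hμV,
        Set.inter_union_distrib_left D S T ▸ Set.union_subset_union hSU hTV,
        hU.union_of_mem_nhds hp hV hμV (inter_mem hUx hVx)⟩
    · intro x hx
      obtain ⟨N, hN, hDN⟩ := hloc' x hx
      obtain ⟨y, hyN, hyD⟩ := mem_closure_iff_nhds.1 hx _ (interior_mem_nhds.2 hN)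
      obtain ⟨W, hWx₀, hWy, hμW, hW⟩ := exists_hasPoincare_mem_nhds (μ := μ) hp hD hDc.2 hx₀ hyD
      refine ⟨N, mem_nhdsWithin_of_mem_nhds hN, W ∪ D ∩ N,
        mem_of_superset hWx₀ Set.subset_union_left,
        measure_union_ne_top hμW (measure_ne_top_of_subset Set.inter_subset_left hμD),
        Set.subset_union_right, ?_⟩
      exact hW.union_of_mem_nhds hp hDN (measure_ne_top_of_subset Set.inter_subset_left hμD)
        (inter_mem hWy (inter_mem (hD.mem_nhds hyD) (mem_interior_iff_mem_nhds.1 hyN)))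
  exact hU.mono_right fun x hx => hDU ⟨hx, subset_closure hx⟩

end Gluing

section Epigraph

variable {E : Type*} [NormedAddCommGroup E] [InnerProductSpace ℝ E]

/-- Inside `W`, the set `D` is the strict epigraph in the direction `e` of the function `h` on the
hyperplane `eᗮ`. -/
def IsEpigraphOn (D : Set E) (e : E) (h : (Submodule.span ℝ {e})ᗮ → ℝ) (W : Set E) : Prop :=
  ∀ y ∈ W, y ∈ D ↔ h ((Submodule.span ℝ {e})ᗮ.orthogonalProjectionOnto y) < ⟪e, y⟫_ℝ

namespace IsEpigraphOn

variable {D W : Set E} {e : E} {h : (Submodule.span ℝ {e})ᗮ → ℝ} {y : E}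

lemma le_inner_of_mem_closure (hDW : IsEpigraphOn D e h W) (hW : IsOpen W) (hh : Continuous h)
    (hyW : y ∈ W) (hy : y ∈ closure D) :
    h ((Submodule.span ℝ {e})ᗮ.orthogonalProjectionOnto y) ≤ ⟪e, y⟫_ℝ := by
  have hclosed : IsClosed
      {y | h ((Submodule.span ℝ {e})ᗮ.orthogonalProjectionOnto y) ≤ ⟪e, y⟫_ℝ} :=
    isClosed_le (hh.comp (ContinuousLinearMap.continuous _)) (by fun_prop)
  exact closure_minimal (fun y hy => ((hDW y hy.1).1 hy.2).le) hclosed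
    (hW.inter_closure ⟨hyW, hy⟩)

lemma inner_eq_of_mem_frontier (hDW : IsEpigraphOn D e h W) (hW : IsOpen W) (hh : Continuous h)
    (hD : IsOpen D) (hyW : y ∈ W) (hy : y ∈ frontier D) :
    ⟪e, y⟫_ℝ = h ((Submodule.span ℝ {e})ᗮ.orthogonalProjectionOnto y) := by
  rw [hD.frontier_eq] at hy
  exact le_antisymm (not_lt.1 fun hlt => hy.2 ((hDW y hyW).2 hlt))
    (hDW.le_inner_of_mem_closure hW hh hyW hy.1)

lemma add_smul_mem (hDW : IsEpigraphOn D e h W) (hW : IsOpen W) (hh : Continuous h)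
    (he : ‖e‖ = 1) (hyW : y ∈ W) (hy : y ∈ closure D) {t : ℝ} (ht : 0 < t)
    (hytW : y + t • e ∈ W) : y + t • e ∈ D := by
  rw [hDW _ hytW, map_add, map_smul,
    Submodule.orthogonalProjectionOnto_orthogonalComplement_singleton_eq_zero, smul_zero, add_zero,
    inner_add_right, inner_smul_right, real_inner_self_eq_norm_sq, he]
  linarith [hDW.le_inner_of_mem_closure hW hh hyW hy]

lemma add_smul_add_mem (hDW : IsEpigraphOn D e h W) (hW : IsOpen W) {K : ℝ≥0}
    (hh : LipschitzWith K h) (he : ‖e‖ = 1) (hyW : y ∈ W) (hy : y ∈ closure D) {t : ℝ} {v : E}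
    (hv : (1 + K) * ‖v‖ < t) (hytW : y + t • e + v ∈ W) : y + t • e + v ∈ D := by
  set P := (Submodule.span ℝ {e})ᗮ.orthogonalProjectionOnto
  have hPe : P e = 0 :=
    Submodule.orthogonalProjectionOnto_orthogonalComplement_singleton_eq_zero e
  have hP : P (y + t • e + v) = P y + P v := by simp [hPe]
  have hhv : h (P y + P v) - h (P y) ≤ K * ‖v‖ := by
    calc h (P y + P v) - h (P y) ≤ K * ‖P y + P v - P y‖ :=
          (le_abs_self _).trans (hh.norm_sub_le _ _)
      _ ≤ K * ‖v‖ := by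
          rw [add_sub_cancel_left]
          gcongr
          exact Submodule.norm_orthogonalProjectionOnto_apply_le _ v
  have hev : -‖v‖ ≤ ⟪e, v⟫_ℝ := by
    simpa [he] using (abs_le.1 (abs_real_inner_le_norm e v)).1
  rw [hDW _ hytW, hP, inner_add_right, inner_add_right, inner_smul_right,
    real_inner_self_eq_norm_sq, he]
  linarith [hDW.le_inner_of_mem_closure hW hh.continuous hyW hy]

lemma exists_translate_mem {x : E} {r : ℝ} (hr : 0 < r)
    (hDW : IsEpigraphOn D e h (Metric.ball x r)) {K : ℝ≥0} (hh : LipschitzWith K h) (he : ‖e‖ = 1)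
    (hx : x ∈ closure D) :
    ∃ ρ ∈ Set.Ioc 0 r, ∃ σ : ℝ, 0 < σ ∧ Metric.ball (x + σ • e) ρ ⊆ D ∧
      ∀ y ∈ Metric.ball x ρ, y ∈ closure D → ∀ t ∈ Set.Ioc 0 σ, y + t • e ∈ D := by
  have hnorm {t : ℝ} (ht : 0 < t) : ‖t • e‖ = t := by
    rw [norm_smul, he, mul_one, Real.norm_of_nonneg ht.le]
  have hρ : r / 2 / (1 + K) ≤ r / 2 := div_le_self (by positivity) (by simp)
  refine ⟨r / 2 / (1 + K), ⟨by positivity, by linarith⟩, r / 2, by positivity, fun y hy => ?_,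
    fun y hy hyD t ht => ?_⟩
  · obtain ⟨v, rfl⟩ : ∃ v, y = x + (r / 2) • e + v := ⟨_, (add_sub_cancel _ y).symm⟩
    rw [mem_ball_iff_norm, add_sub_cancel_left] at hy
    refine hDW.add_smul_add_mem Metric.isOpen_ball hh he (Metric.mem_ball_self hr) hx
      ((lt_div_iff₀' (by positivity)).1 hy) ?_
    rw [mem_ball_iff_norm, add_assoc, add_sub_cancel_left]
    linarith [norm_add_le ((r / 2) • e) v, hnorm (half_pos hr)]
  · rw [mem_ball_iff_norm] at hy
    refine hDW.add_smul_mem Metric.isOpen_ball hh.continuous he ?_ hyD ht.1 ?_ <;>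
      rw [mem_ball_iff_norm]
    · linarith
    · rw [add_sub_right_comm]
      linarith [norm_add_le (y - x) (t • e), hnorm ht.1, ht.2]

end IsEpigraphOn

end Epigraph

lemma IsLipschitzDomain.hasPoincare {d : ℕ} {D : Set (Rd d)} (hD : IsLipschitzDomain D) {p : ℝ≥0∞}
    [Fact (1 ≤ p)] (hp : p ≠ ⊤) : HasPoincare volume p D D := by
  refine hasPoincare_of_forall_frontier hp hD.isOpen hD.isConnected hD.isBounded fun x hx => ?_
  obtain ⟨e, r, K, h, he, hr, hh, hDr⟩ := hD.lipschitz_boundary x hx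
  obtain ⟨ρ, hρ, σ, hσ, hball, hup⟩ :=
    IsEpigraphOn.exists_translate_mem hr hDr hh he (frontier_subset_closure hx)
  refine ⟨_, Metric.ball_mem_nhds x hρ.1, (hasPoincare_ball hp hρ.1 hball).of_translate hp
    measurableSet_ball hD.isOpen.measurableSet (σ • e) (fun y hy => ?_) fun y hy t ht => ?_⟩
  · simpa [mem_ball_iff_norm] using hy.2
  · rcases ht.1.eq_or_lt with rfl | ht0
    · simpa using hy.1
    · rw [smul_smul]
      exact hup y hy.2 (subset_closure hy.1) _
        ⟨mul_pos ht0 hσ, mul_le_of_le_one_left hσ.le ht.2⟩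

lemma euclideanHausdorffMeasure_image_le {X Y : Type*} [EMetricSpace X] [MeasurableSpace X]
    [BorelSpace X] [EMetricSpace Y] [MeasurableSpace Y] [BorelSpace Y] {K : ℝ≥0} {f : X → Y}
    (hf : LipschitzWith K f) (n : ℕ) (s : Set X) :
    μHE[n] (f '' s) ≤ (K : ℝ≥0∞) ^ n * μHE[n] s := by
  simp only [Measure.euclideanHausdorffMeasure_def, Measure.smul_apply, ENNReal.smul_def,
    smul_eq_mul]
  rw [mul_left_comm, ← ENNReal.rpow_natCast]
  gcongr
  exact hf.hausdorffMeasure_image_le (Nat.cast_nonneg n) s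

section Graph

variable {E : Type*} [NormedAddCommGroup E] [InnerProductSpace ℝ E] {e : E}
  {h : (Submodule.span ℝ {e})ᗮ → ℝ}

/-- The parametrization of the graph of `h : eᗮ → ℝ`, whose values are heights along `e`. -/
def graphMap (e : E) (h : (Submodule.span ℝ {e})ᗮ → ℝ) (w : (Submodule.span ℝ {e})ᗮ) : E :=
  w + h w • e

lemma lipschitzWith_graphMap (he : ‖e‖ = 1) {K : ℝ≥0} (hh : LipschitzWith K h) :
    LipschitzWith (1 + K) (graphMap e h) := by
  refine (LipschitzWith.subtype_val _).add (LipschitzWith.of_dist_le_mul fun a b => ?_)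
  rw [dist_eq_norm, ← sub_smul, norm_smul, he, mul_one, ← dist_eq_norm]
  exact hh.dist_le_mul a b

lemma graphMap_orthogonalProjectionOnto (he : ‖e‖ = 1) {z : E}
    (hz : ⟪e, z⟫_ℝ = h ((Submodule.span ℝ {e})ᗮ.orthogonalProjectionOnto z)) :
    graphMap e h ((Submodule.span ℝ {e})ᗮ.orthogonalProjectionOnto z) = z := by
  rw [graphMap, ← hz, ← Submodule.starProjection_unit_singleton ℝ he, add_comm]
  exact Submodule.starProjection_add_starProjection_orthogonal (K := Submodule.span ℝ {e}) z

variable [FiniteDimensional ℝ E] [MeasurableSpace E] [BorelSpace E]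

lemma measurable_graphMap (hh : Measurable h) : Measurable (graphMap e h) :=
  measurable_subtype_coe.add (hh.smul_const e)

lemma measurePreserving_graphMap_add_smul (he : ‖e‖ = 1) (hh : Measurable h) :
    MeasurePreserving (fun q : ℝ × (Submodule.span ℝ {e})ᗮ => graphMap e h q.2 + q.1 • e) := by
  have hshear : MeasurePreserving (fun q : (Submodule.span ℝ {e})ᗮ × ℝ => (q.1, h q.1 + q.2)) :=
    (MeasurePreserving.id volume).skew_product (by fun_prop)
      (ae_of_all _ fun w => map_add_left_eq_self _ _)
  have hline := (LinearIsometryEquiv.toSpanUnitSingleton e he).measurePreserving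
  have hsplit := ((Submodule.span ℝ {e}).measurePreserving_measurableEquivProd (0 : E)).symm
  rw [InnerProductSpace.euclideanHausdorffMeasure_eq_volume] at hsplit
  convert hsplit.comp ((hline.prod (MeasurePreserving.id volume)).comp
    (Measure.measurePreserving_swap.comp (hshear.comp Measure.measurePreserving_swap))) using 1
  · ext ⟨t, w⟩
    simp [graphMap, add_smul, add_comm, add_left_comm]
  · rfl

lemma euclideanHausdorffMeasure_restrict_le_map_graphMap (he : ‖e‖ = 1) {K : ℝ≥0}
    (hh : LipschitzWith K h) {S : Set E}
    (hS : ∀ z ∈ S, ⟪e, z⟫_ℝ = h ((Submodule.span ℝ {e})ᗮ.orthogonalProjectionOnto z)) :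
    (μHE[Module.finrank ℝ (Submodule.span ℝ {e})ᗮ] : Measure E).restrict S ≤
      ((1 + K : ℝ≥0) : ℝ≥0∞) ^ Module.finrank ℝ (Submodule.span ℝ {e})ᗮ •
        (volume.restrict (graphMap e h ⁻¹' S)).map (graphMap e h) := by
  have hΓ := lipschitzWith_graphMap he hh
  refine Measure.le_iff.2 fun T hT => ?_
  rw [Measure.restrict_apply hT, Measure.smul_apply, Measure.map_apply hΓ.continuous.measurable hT,
    Measure.restrict_apply (hΓ.continuous.measurable hT), smul_eq_mul,
    ← InnerProductSpace.euclideanHausdorffMeasure_eq_volume]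
  refine (measure_mono fun z hz => ?_).trans (euclideanHausdorffMeasure_image_le hΓ _ _)
  have hPz := graphMap_orthogonalProjectionOnto he (hS z hz.2)
  exact ⟨_, by simpa [hPz] using hz, hPz⟩

end Graph

section Trace

/-- A trace inequality in the exponent `p`: the `L^p(ν)` norm is controlled by the `W^{1,p}(μ)`
norm. In the application `ν` is carried by the boundary of the support of `μ`. -/
def HasTraceInequality {E : Type*} [NormedAddCommGroup E] [NormedSpace ℝ E] [MeasurableSpace E]
    (ν μ : Measure E) (p : ℝ≥0∞) : Prop :=
  ∃ C : ℝ≥0∞, C ≠ ⊤ ∧ ∀ φ : E → ℝ, ContDiff ℝ 1 φ →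
    eLpNorm φ p ν ≤ C * (eLpNorm φ p μ + eLpNorm (fderiv ℝ φ) p μ)

lemma hasTraceInequality_restrict_of_isCompact {E : Type*} [NormedAddCommGroup E] [NormedSpace ℝ E]
    [MeasurableSpace E] {ν μ : Measure E} {p : ℝ≥0∞} [Fact (1 ≤ p)] (hp : p ≠ ⊤) {S : Set E}
    (hS : IsCompact S)
    (hloc : ∀ x ∈ S, ∃ N ∈ 𝓝 x, HasTraceInequality (ν.restrict (N ∩ S)) μ p) :
    HasTraceInequality (ν.restrict S) μ p := by
  suffices HasTraceInequality (ν.restrict (S ∩ S)) μ p by rwa [Set.inter_self] at this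
  refine hS.induction_on (p := fun T => HasTraceInequality (ν.restrict (T ∩ S)) μ p) ?_ ?_ ?_ ?_
  · exact ⟨0, by simp, fun φ _ => by simp⟩
  · rintro T T' hT ⟨C, hC, h⟩
    exact ⟨C, hC, fun φ hφ => le_trans (by gcongr) (h φ hφ)⟩
  · rintro T T' ⟨C, hC, h⟩ ⟨C', hC', h'⟩
    refine ⟨C + C', by finiteness, fun φ hφ => ?_⟩
    rw [Set.union_inter_distrib_right, add_mul]
    exact (eLpNorm_restrict_union_le _ hp _ _).trans (add_le_add (h φ hφ) (h' φ hφ))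
  · intro x hx
    obtain ⟨N, hN, h⟩ := hloc x hx
    exact ⟨N, mem_nhdsWithin_of_mem_nhds hN, h⟩

variable {E : Type*} [NormedAddCommGroup E] [InnerProductSpace ℝ E] [FiniteDimensional ℝ E]
  [MeasurableSpace E] [BorelSpace E] {e : E} {h : (Submodule.span ℝ {e})ᗮ → ℝ} {p : ℝ≥0∞}

lemma eLpNorm_comp_graphMap_add_smul_le {F : Type*} [NormedAddCommGroup F] (he : ‖e‖ = 1)
    (hh : Measurable h) {S D : Set E} (hD : MeasurableSet D) {σ : ℝ}
    (hSD : ∀ z ∈ S, ∀ t ∈ Set.Ioc 0 σ, z + t • e ∈ D) {f : E → F} (hf : Continuous f) :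
    eLpNorm (fun q : ℝ × (Submodule.span ℝ {e})ᗮ => f (graphMap e h q.2 + q.1 • e)) p
        ((volume.restrict (Set.Ioc 0 σ)).prod (volume.restrict (graphMap e h ⁻¹' S))) ≤
      eLpNorm f p (volume.restrict D) := by
  rw [Measure.prod_restrict]
  exact eLpNorm_comp_restrict_le (measurePreserving_graphMap_add_smul he hh)
    hf.aestronglyMeasurable hD fun q hq => hSD _ hq.2 _ hq.1

variable [Fact (1 ≤ p)]

lemma exists_mul_eLpNorm_graphMap_add_smul_le {F : Type*} [NormedAddCommGroup F] (hp : p ≠ ⊤)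
    (he : ‖e‖ = 1) (hh : Measurable h) {S D : Set E} (hD : MeasurableSet D) {σ : ℝ} (hσ : 0 < σ)
    (hSD : ∀ z ∈ S, ∀ t ∈ Set.Ioc 0 σ, z + t • e ∈ D) {f : E → F} (hf : Continuous f) :
    ∃ t ∈ Set.Ioc 0 σ, ENNReal.ofReal σ ^ (1 / p.toReal) *
        eLpNorm (fun w => f (graphMap e h w + t • e)) p (volume.restrict (graphMap e h ⁻¹' S)) ≤
      eLpNorm f p (volume.restrict D) := by
  have hp0 : p ≠ 0 := (zero_lt_one.trans_le (Fact.out : 1 ≤ p)).ne'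
  have hσv : volume (Set.Ioc 0 σ) = ENNReal.ofReal σ := by rw [Real.volume_Ioc, sub_zero]
  have hΓ := measurable_graphMap (e := e) hh
  obtain ⟨t, ht, hslice⟩ := exists_mem_measure_mul_eLpNorm_prodMk_le (p := p)
    (μ := (volume : Measure ℝ)) (ν := volume.restrict (graphMap e h ⁻¹' S)) (s := Set.Ioc 0 σ)
    (f := fun q => f (graphMap e h q.2 + q.1 • e))
    (hf.stronglyMeasurable.comp_measurable (by fun_prop)).aestronglyMeasurable
    (by simpa [hσv] using hσ) measure_Ioc_lt_top.ne hp0 hp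
  rw [hσv] at hslice
  exact ⟨t, ht, hslice.trans (eLpNorm_comp_graphMap_add_smul_le he hh hD hSD hf)⟩

lemma eLpNorm_graphMap_add_smul_sub_le {F : Type*} [NormedAddCommGroup F] [NormedSpace ℝ F]
    (hp : p ≠ ⊤) (he : ‖e‖ = 1) (hh : Measurable h) {S D : Set E} (hD : MeasurableSet D) {σ : ℝ}
    (hSD : ∀ z ∈ S, ∀ t ∈ Set.Ioc 0 σ, z + t • e ∈ D) {t : ℝ} (ht : t ∈ Set.Ioc 0 σ)
    {φ : E → F} (hφ : ContDiff ℝ 1 φ) :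
    eLpNorm (fun w => φ (graphMap e h w + t • e) - φ (graphMap e h w)) p
        (volume.restrict (graphMap e h ⁻¹' S)) ≤
      ENNReal.ofReal σ ^ (1 - 1 / p.toReal) * eLpNorm (fderiv ℝ φ) p (volume.restrict D) := by
  have heₑ : ‖e‖ₑ = (1 : ℝ≥0) := by rw [← ofReal_norm, he, ENNReal.ofReal_one, ENNReal.coe_one]
  have hsub := eLpNorm_sub_le_eLpNorm_fderiv_segment
    (ν := volume.restrict (graphMap e h ⁻¹' S)) hp hφ (measurable_graphMap hh)
    (measurable_const (a := e)) (ae_of_all _ fun _ => heₑ.le) ht.1.le ht.2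
  rw [ENNReal.coe_one, one_mul, ← Measure.restrict_congr_set Ioc_ae_eq_Icc] at hsub
  refine hsub.trans ?_
  gcongr
  exact eLpNorm_comp_graphMap_add_smul_le he hh hD hSD (hφ.continuous_fderiv one_ne_zero)

lemma exists_eLpNorm_comp_graphMap_le (hp : p ≠ ⊤) (he : ‖e‖ = 1) (hh : Measurable h)
    {S D : Set E} (hD : MeasurableSet D) {σ : ℝ} (hσ : 0 < σ)
    (hSD : ∀ z ∈ S, ∀ t ∈ Set.Ioc 0 σ, z + t • e ∈ D) :
    ∃ C : ℝ≥0∞, C ≠ ⊤ ∧ ∀ φ : E → ℝ, ContDiff ℝ 1 φ →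
      eLpNorm (φ ∘ graphMap e h) p (volume.restrict (graphMap e h ⁻¹' S)) ≤
        C * (eLpNorm φ p (volume.restrict D) + eLpNorm (fderiv ℝ φ) p (volume.restrict D)) := by
  set ν := volume.restrict (graphMap e h ⁻¹' S)
  set m := ENNReal.ofReal σ ^ (1 / p.toReal)
  set M := ENNReal.ofReal σ ^ (1 - 1 / p.toReal)
  have hσ0 : ENNReal.ofReal σ ≠ 0 := by simpa using hσ
  have hm : m ≠ 0 := (ENNReal.rpow_pos hσ0.bot_lt ENNReal.ofReal_ne_top).ne'
  have hm' : m ≠ ⊤ := ENNReal.rpow_ne_top_of_ne_zero hσ0 ENNReal.ofReal_ne_top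
  have hM : M ≠ ⊤ := ENNReal.rpow_ne_top_of_ne_zero hσ0 ENNReal.ofReal_ne_top
  refine ⟨m⁻¹ + M, ENNReal.add_ne_top.2 ⟨ENNReal.inv_ne_top.2 hm, hM⟩, fun φ hφ => ?_⟩
  have hφΓ (t : ℝ) : AEStronglyMeasurable (fun w => φ (graphMap e h w + t • e)) ν :=
    (hφ.continuous.measurable.comp
      ((measurable_graphMap hh).add_const _)).aestronglyMeasurable
  have hφΓ₀ : AEStronglyMeasurable (fun w => φ (graphMap e h w)) ν := by simpa using hφΓ 0
  obtain ⟨t, ht, hslice⟩ :=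
    exists_mul_eLpNorm_graphMap_add_smul_le hp he hh hD hσ hSD hφ.continuous
  calc eLpNorm (φ ∘ graphMap e h) p ν
      = eLpNorm ((fun w => φ (graphMap e h w + t • e)) -
          fun w => φ (graphMap e h w + t • e) - φ (graphMap e h w)) p ν := by
        congr 1
        ext w
        simp
    _ ≤ eLpNorm (fun w => φ (graphMap e h w + t • e)) p ν +
          eLpNorm (fun w => φ (graphMap e h w + t • e) - φ (graphMap e h w)) p ν :=
        eLpNorm_sub_le (hφΓ t) ((hφΓ t).sub hφΓ₀) Fact.out
    _ ≤ m⁻¹ * eLpNorm φ p (volume.restrict D) + M * eLpNorm (fderiv ℝ φ) p (volume.restrict D) :=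
        add_le_add ((ENNReal.mul_le_iff_le_inv hm hm').1 hslice)
          (eLpNorm_graphMap_add_smul_sub_le hp he hh hD hSD ht hφ)
    _ ≤ (m⁻¹ + M) * (eLpNorm φ p (volume.restrict D) +
          eLpNorm (fderiv ℝ φ) p (volume.restrict D)) := by
        rw [add_mul]
        gcongr <;> simp

lemma hasTraceInequality_restrict_graph (hp : p ≠ ⊤) (he : ‖e‖ = 1) {K : ℝ≥0}
    (hh : LipschitzWith K h) {S D : Set E}
    (hS : ∀ z ∈ S, ⟪e, z⟫_ℝ = h ((Submodule.span ℝ {e})ᗮ.orthogonalProjectionOnto z))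
    (hD : MeasurableSet D) {σ : ℝ} (hσ : 0 < σ)
    (hSD : ∀ z ∈ S, ∀ t ∈ Set.Ioc 0 σ, z + t • e ∈ D) :
    HasTraceInequality ((μHE[Module.finrank ℝ (Submodule.span ℝ {e})ᗮ] : Measure E).restrict S)
      (volume.restrict D) p := by
  have hΓ := (lipschitzWith_graphMap he hh).continuous.measurable
  obtain ⟨C, hC, hΓC⟩ :=
    exists_eLpNorm_comp_graphMap_le hp he hh.continuous.measurable hD hσ hSD
  set L := ((1 + K : ℝ≥0) : ℝ≥0∞) ^ Module.finrank ℝ (Submodule.span ℝ {e})ᗮ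
  have hL : L ^ (1 / p.toReal) ≠ ⊤ := ENNReal.rpow_ne_top_of_nonneg (by positivity) (by finiteness)
  refine ⟨L ^ (1 / p.toReal) * C, by finiteness, fun φ hφ => ?_⟩
  calc eLpNorm φ p ((μHE[Module.finrank ℝ (Submodule.span ℝ {e})ᗮ] : Measure E).restrict S)
      ≤ eLpNorm φ p (L • (volume.restrict (graphMap e h ⁻¹' S)).map (graphMap e h)) :=
        eLpNorm_mono_measure _ (euclideanHausdorffMeasure_restrict_le_map_graphMap he hh hS)
    _ = L ^ (1 / p.toReal) *
          eLpNorm (φ ∘ graphMap e h) p (volume.restrict (graphMap e h ⁻¹' S)) := by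
        rw [eLpNorm_smul_measure_of_ne_top hp, smul_eq_mul, ENNReal.toReal_div,
          ENNReal.toReal_one,
          eLpNorm_map_measure hφ.continuous.aestronglyMeasurable hΓ.aemeasurable]
    _ ≤ _ := by
        rw [mul_assoc]
        gcongr
        exact hΓC φ hφ

end Trace

section Frontier

lemma exists_add_smul_mem_frontier {E : Type*} [NormedAddCommGroup E] [NormedSpace ℝ E]
    {D : Set E} (hD : Bornology.IsBounded D) {x : E} (hx : x ∈ D) {v : E} (hv : v ≠ 0) :
    ∃ t : ℝ, x + t • v ∈ frontier D := by
  set T : Set ℝ := (fun t : ℝ => x + t • v) ⁻¹' D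
  have hT : T ≠ Set.univ := by
    obtain ⟨R, hR⟩ := hD.exists_norm_le
    have hmem : (R + ‖x‖ + 1) / ‖v‖ ∉ T := fun hmem => by
      have hR0 : 0 ≤ R := (norm_nonneg x).trans (hR x hx)
      have hlong : ‖((R + ‖x‖ + 1) / ‖v‖) • v‖ = R + ‖x‖ + 1 := by
        rw [norm_smul, Real.norm_of_nonneg (by positivity),
          div_mul_cancel₀ _ (norm_ne_zero_iff.2 hv)]
      have htri := norm_sub_le (x + ((R + ‖x‖ + 1) / ‖v‖) • v) x
      rw [add_sub_cancel_left, hlong] at htri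
      linarith [hR _ hmem]
    exact fun hT => hmem (hT ▸ Set.mem_univ _)
  obtain ⟨t, ht⟩ := nonempty_frontier_iff.2 ⟨⟨0, by simpa [T] using hx⟩, hT⟩
  have hcont : Continuous fun t : ℝ => x + t • v := by fun_prop
  exact ⟨t, hcont.frontier_preimage_subset D ht⟩

variable {E : Type*} [NormedAddCommGroup E] [InnerProductSpace ℝ E] [FiniteDimensional ℝ E]
  {e : E}

lemma finrank_orthogonal_span_singleton_add_one (he : e ≠ 0) :
    Module.finrank ℝ (Submodule.span ℝ {e})ᗮ + 1 = Module.finrank ℝ E := by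
  rw [add_comm, ← finrank_span_singleton (K := ℝ) he, Submodule.finrank_add_finrank_orthogonal]

variable [MeasurableSpace E] [BorelSpace E]

lemma euclideanHausdorffMeasure_frontier_ne_zero {D : Set E} (hD : IsOpen D)
    (hDb : Bornology.IsBounded D) (hDne : D.Nonempty) (he : e ≠ 0) :
    (μHE[Module.finrank ℝ (Submodule.span ℝ {e})ᗮ] : Measure E) (frontier D) ≠ 0 := by
  set P := (Submodule.span ℝ {e})ᗮ.orthogonalProjectionOnto
  have hP : Function.Surjective P := fun w => ⟨w, by simp [P]⟩
  have hsub : P '' D ⊆ P '' frontier D := by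
    rintro _ ⟨x, hx, rfl⟩
    obtain ⟨t, ht⟩ := exists_add_smul_mem_frontier hDb hx he
    refine ⟨_, ht, ?_⟩
    rw [map_add, map_smul,
      Submodule.orthogonalProjectionOnto_orthogonalComplement_singleton_eq_zero, smul_zero,
      add_zero]
  have hpos : 0 < volume (P '' D) :=
    (P.isOpenMap hP D hD).measure_pos volume (hDne.image P)
  rw [← InnerProductSpace.euclideanHausdorffMeasure_eq_volume] at hpos
  have hproj := euclideanHausdorffMeasure_image_le
    (Submodule.lipschitzWith_orthogonalProjectionOnto (Submodule.span ℝ {e})ᗮ)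
    (Module.finrank ℝ (Submodule.span ℝ {e})ᗮ) (frontier D)
  rw [ENNReal.coe_one, one_pow, one_mul] at hproj
  exact (hpos.trans_le ((measure_mono hsub).trans hproj)).ne'

end Frontier

namespace IsLipschitzDomain

variable {d : ℕ} {D : Set (Rd d)}

lemma hasTraceInequality (hD : IsLipschitzDomain D) {p : ℝ≥0∞} [Fact (1 ≤ p)] (hp : p ≠ ⊤) :
    HasTraceInequality (surfaceMeasure D) (volume.restrict D) p := by
  have hcompact : IsCompact (frontier D) :=
    hD.isBounded.isCompact_closure.of_isClosed_subset isClosed_frontier frontier_subset_closure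
  refine hasTraceInequality_restrict_of_isCompact hp hcompact fun x hx => ?_
  obtain ⟨e, r, K, h, he, hr, hh, hDr⟩ := hD.lipschitz_boundary x hx
  obtain ⟨ρ, hρ, σ, hσ, -, hup⟩ :=
    IsEpigraphOn.exists_translate_mem hr hDr hh he (frontier_subset_closure hx)
  have hfinrank : d - 1 = Module.finrank ℝ (Submodule.span ℝ {e})ᗮ := by
    have := finrank_orthogonal_span_singleton_add_one (e := e) (by rintro rfl; simp at he)
    rw [finrank_euclideanSpace_fin] at this
    omega
  refine ⟨Metric.ball x ρ, Metric.ball_mem_nhds x hρ.1, ?_⟩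
  rw [hfinrank]
  exact hasTraceInequality_restrict_graph hp he hh
    (fun z hz => IsEpigraphOn.inner_eq_of_mem_frontier hDr Metric.isOpen_ball hh.continuous
      hD.isOpen (Metric.ball_subset_ball hρ.2 hz.1) hz.2)
    hD.isOpen.measurableSet hσ fun z hz => hup z hz.1 (frontier_subset_closure hz.2)

lemma isFiniteMeasure_surfaceMeasure (hD : IsLipschitzDomain D) :
    IsFiniteMeasure (surfaceMeasure D) := by
  obtain ⟨C, hC, h⟩ := hD.hasTraceInequality (p := 1) ENNReal.one_ne_top
  refine ⟨(?_ : surfaceMeasure D Set.univ ≤ C * volume D).trans_lt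
    (ENNReal.mul_lt_top hC.lt_top hD.isBounded.measure_lt_top)⟩
  have hfderiv : eLpNorm (fderiv ℝ fun _ : Rd d => (1 : ℝ)) 1 (volume.restrict D) = 0 := by
    rw [← eLpNorm_norm]
    simp
  have hone := h (fun _ => 1) contDiff_const
  rw [hfderiv, add_zero] at hone
  simpa [eLpNorm_one_eq_lintegral_enorm] using hone

lemma surfaceMeasure_ne_zero (hD : IsLipschitzDomain D) (hd : d ≠ 0) :
    surfaceMeasure D Set.univ ≠ 0 := by
  set e : Rd d := EuclideanSpace.single ⟨0, Nat.pos_of_ne_zero hd⟩ 1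
  have he : e ≠ 0 := by simp [e]
  have hfinrank := finrank_orthogonal_span_singleton_add_one he
  have hdim : d - 1 = Module.finrank ℝ (Submodule.span ℝ {e})ᗮ := by
    rw [finrank_euclideanSpace_fin] at hfinrank
    omega
  rw [surfaceMeasure, Measure.restrict_apply_univ, hdim]
  exact euclideanHausdorffMeasure_frontier_ne_zero hD.isOpen hD.isBounded hD.isConnected.nonempty he

lemma exists_eLpNorm_sub_const_le (hD : IsLipschitzDomain D) {p : ℝ≥0∞} [Fact (1 ≤ p)]
    (hp : p ≠ ⊤) : ∃ C : ℝ≥0, ∀ φ : Rd d → ℝ, ContDiff ℝ 1 φ → ∃ c : ℝ,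
      eLpNorm (fun x => φ x - c) p (volume.restrict D) ≤
          C * eLpNorm (fderiv ℝ φ) p (volume.restrict D) ∧
        eLpNorm (fun x => φ x - c) p (surfaceMeasure D) ≤
          C * eLpNorm (fderiv ℝ φ) p (volume.restrict D) := by
  obtain ⟨C, hC, hpoincare⟩ := hD.hasPoincare hp
  obtain ⟨C', hC', htrace⟩ := hD.hasTraceInequality hp
  lift C to ℝ≥0 using hC
  lift C' to ℝ≥0 using hC'
  refine ⟨C + C' * (C + 1), fun φ hφ => ?_⟩
  obtain ⟨c, hc⟩ := hpoincare φ hφ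
  set G := eLpNorm (fderiv ℝ φ) p (volume.restrict D)
  have hboundary : eLpNorm (fun x => φ x - c) p (surfaceMeasure D) ≤ C' * ((C + 1) * G) := by
    have h := htrace (fun x => φ x - c) (hφ.sub contDiff_const)
    have hfderiv : fderiv ℝ (fun x => φ x - c) = fderiv ℝ φ := funext fun x => fderiv_sub_const c
    rw [hfderiv] at h
    refine h.trans ?_
    rw [add_mul, one_mul]
    gcongr
  push_cast
  exact ⟨c, hc.trans (by gcongr; exact le_self_add),
    hboundary.trans (by rw [← mul_assoc]; gcongr; exact le_add_self)⟩

end IsLipschitzDomain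

section Symmetric

variable {H : Type*} [NormedAddCommGroup H] [InnerProductSpace ℝ H] (T : H →L[ℝ] H)

lemma abs_inner_apply_self_le_norm {g : H} (hg : ‖g‖ = 1) : |⟪T g, g⟫_ℝ| ≤ ‖T‖ :=
  calc |⟪T g, g⟫_ℝ| ≤ ‖T g‖ * ‖g‖ := abs_real_inner_le_norm _ _
    _ ≤ ‖T‖ := by simpa [hg] using T.le_opNorm g

variable {T}

lemma sSup_sphere_abs_inner_apply_self_eq_norm (hT : (T : H →ₗ[ℝ] H).IsSymmetric) :
    sSup ((fun g => |⟪T g, g⟫_ℝ|) '' Metric.sphere 0 1) = ‖T‖ := by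
  have hbound : ∀ a ∈ (fun g => |⟪T g, g⟫_ℝ|) '' Metric.sphere 0 1, a ≤ ‖T‖ := by
    rintro _ ⟨g, hg, rfl⟩
    exact abs_inner_apply_self_le_norm T (mem_sphere_zero_iff_norm.1 hg)
  refine le_antisymm (Real.sSup_le hbound (norm_nonneg T)) ?_
  rw [T.norm_eq_iSup_rayleighQuotient hT]
  refine ciSup_le fun x => ?_
  rcases eq_or_ne x 0 with rfl | hx
  · rw [T.rayleighQuotient_apply_zero, abs_zero]
    exact Real.sSup_nonneg (by rintro _ ⟨g, -, rfl⟩; exact abs_nonneg _)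
  · refine le_csSup ⟨_, hbound⟩ ⟨‖x‖⁻¹ • x, ?_, ?_⟩
    · simp [norm_smul, hx]
    · rw [← T.rayleigh_smul x (inv_ne_zero (norm_ne_zero_iff.2 hx))]
      simp [ContinuousLinearMap.rayleighQuotient, ContinuousLinearMap.reApplyInnerSelf_apply,
        norm_smul, hx]

end Symmetric

section LaxMilgram

variable {V F : Type*} [NormedAddCommGroup V] [InnerProductSpace ℝ V] [CompleteSpace V]
  [NormedAddCommGroup F] [InnerProductSpace ℝ F] [CompleteSpace F]
  {a : V →L[ℝ] V →L[ℝ] ℝ} (ha : IsCoercive a) (T : V →L[ℝ] F)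

/-- The Lax–Milgram solution operator: `coerciveSolve ha T g` is the `u` such that
`a u v = ⟪g, T v⟫` for all `v`. -/
def coerciveSolve : F →L[ℝ] V :=
  (ha.continuousLinearEquivOfBilin.symm : V →L[ℝ] V).comp (ContinuousLinearMap.adjoint T)

lemma apply_coerciveSolve (g : F) (v : V) : a (coerciveSolve ha T g) v = ⟪g, T v⟫_ℝ := by
  rw [← ha.continuousLinearEquivOfBilin_apply, ← ContinuousLinearMap.adjoint_inner_left]
  simp [coerciveSolve]

lemma eq_coerciveSolve_iff {g : F} {u : V} :
    u = coerciveSolve ha T g ↔ ∀ v, a u v = ⟪g, T v⟫_ℝ := by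
  refine ⟨fun h v => h ▸ apply_coerciveSolve ha T g v, fun h => ?_⟩
  have hu := ha.unique_continuousLinearEquivOfBilin (v := u)
    (f := ContinuousLinearMap.adjoint T g) fun v => by
      rw [ContinuousLinearMap.adjoint_inner_left, h]
  exact ((ContinuousLinearEquiv.symm_apply_eq _).2 hu).symm

lemma inner_comp_coerciveSolve (f g : F) :
    ⟪f, T (coerciveSolve ha T g)⟫_ℝ = a (coerciveSolve ha T f) (coerciveSolve ha T g) :=
  (apply_coerciveSolve ha T f _).symm

lemma isSymmetric_comp_coerciveSolve (hsymm : ∀ u v, a u v = a v u) :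
    (T.comp (coerciveSolve ha T) : F →ₗ[ℝ] F).IsSymmetric := fun f g => by
  simp only [ContinuousLinearMap.coe_coe, ContinuousLinearMap.comp_apply]
  rw [real_inner_comm, inner_comp_coerciveSolve, inner_comp_coerciveSolve, hsymm]

end LaxMilgram

section MeanZero

/-- An estimate modulo the line `ℝ o` becomes an estimate on the kernel of any functional which
does not vanish at `o`. -/
lemma exists_norm_le_mul_norm_of_mem_closure {H E : Type*} [NormedAddCommGroup H] [NormedSpace ℝ H]
    [NormedAddCommGroup E] [NormedSpace ℝ E] (G : H →L[ℝ] E) (ℓ : H →L[ℝ] ℝ) {o : H}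
    (ho : ℓ o ≠ 0) {S : Set H} {C : ℝ} (h : ∀ p ∈ S, ∃ c : ℝ, ‖p - c • o‖ ≤ C * ‖G p‖) :
    ∃ C' : ℝ, ∀ p ∈ closure S, ℓ p = 0 → ‖p‖ ≤ C' * ‖G p‖ := by
  set Q : H →L[ℝ] H := .id ℝ H - ((ℓ o)⁻¹ • ℓ).smulRight o
  have hQ : ∀ p, Q p = p - ((ℓ o)⁻¹ * ℓ p) • o := fun p => rfl
  have hQo : Q o = 0 := by rw [hQ, inv_mul_cancel₀ ho, one_smul, sub_self]
  have hle : ∀ p ∈ S, ‖Q p‖ ≤ ‖Q‖ * C * ‖G p‖ := fun p hp => by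
    obtain ⟨c, hc⟩ := h p hp
    calc ‖Q p‖ = ‖Q (p - c • o)‖ := by rw [map_sub, map_smul, hQo, smul_zero, sub_zero]
      _ ≤ ‖Q‖ * (C * ‖G p‖) := Q.le_opNorm_of_le hc
      _ = ‖Q‖ * C * ‖G p‖ := (mul_assoc _ _ _).symm
  refine ⟨‖Q‖ * C, fun p hp hℓ => ?_⟩
  have hclosed : IsClosed {p | ‖Q p‖ ≤ ‖Q‖ * C * ‖G p‖} :=
    isClosed_le (by fun_prop) (by fun_prop)
  have hQp : ‖Q p‖ ≤ ‖Q‖ * C * ‖G p‖ := closure_minimal hle hclosed hp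
  simpa [hQ, hℓ] using hQp

variable {X : Type*} [MeasurableSpace X] {μ : Measure X}

lemma inner_eq_integral_mul (f g : Lp ℝ 2 μ) : ⟪f, g⟫_ℝ = ∫ x, f x * g x ∂μ := by
  rw [L2.inner_def]
  exact integral_congr_ae (.of_forall fun x => mul_comm _ _)

lemma continuous_integral_mul {ψ : X → ℝ} (hψ : MemLp ψ 2 μ) :
    Continuous fun f : Lp ℝ 2 μ => ∫ x, f x * ψ x ∂μ := by
  have hinner : ∀ f : Lp ℝ 2 μ, ∫ x, f x * ψ x ∂μ = ⟪f, hψ.toLp ψ⟫_ℝ := fun f => by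
    rw [inner_eq_integral_mul]
    refine integral_congr_ae ?_
    filter_upwards [hψ.coeFn_toLp] with x hx
    rw [hx]
  simp_rw [hinner]
  fun_prop

variable (μ) [IsFiniteMeasure μ]

/-- The integral as a continuous linear functional on `L²(μ)`. -/
def integralL2 : Lp ℝ 2 μ →L[ℝ] ℝ := innerSL ℝ (Lp.const 2 μ 1)

variable {μ}

@[simp]
lemma integralL2_apply (f : Lp ℝ 2 μ) : integralL2 μ f = ∫ x, f x ∂μ := by
  rw [integralL2, innerSL_apply_apply, ← indicatorConstLp_univ, L2.inner_indicatorConstLp_one,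
    setIntegral_univ]

lemma integralL2_const (c : ℝ) : integralL2 μ (Lp.const 2 μ c) = c * μ.real Set.univ := by
  rw [integralL2_apply, integral_congr_ae (Lp.coeFn_const 2 μ c)]
  simp [mul_comm]

variable (μ)

/-- The mean-zero functions of `L²(μ)`. -/
def meanZero : Submodule ℝ (Lp ℝ 2 μ) := (integralL2 μ).ker

instance : CompleteSpace (meanZero μ) := (integralL2 μ).isClosed_ker.completeSpace_coe

variable {μ}

lemma mem_meanZero {f : Lp ℝ 2 μ} : f ∈ meanZero μ ↔ ∫ x, f x ∂μ = 0 := by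
  rw [meanZero, LinearMap.mem_ker]
  simp

lemma smul_Lp_const_one (c : ℝ) : c • Lp.const 2 μ (1 : ℝ) = Lp.const 2 μ c := by
  simpa using (map_smul (Lp.constL 2 μ ℝ) c (1 : ℝ)).symm

lemma inner_const_eq_zero {g : Lp ℝ 2 μ} (hg : g ∈ meanZero μ) (c : ℝ) :
    ⟪g, Lp.const 2 μ c⟫_ℝ = 0 := by
  rw [← smul_Lp_const_one, inner_smul_right, real_inner_comm]
  exact mul_eq_zero_of_right c hg

end MeanZero

section WeakGradient

lemma setIntegral_mul_fderiv_eq_neg {E : Type*} [NormedAddCommGroup E] [NormedSpace ℝ E]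
    [FiniteDimensional ℝ E] [MeasurableSpace E] [BorelSpace E] {μ : Measure E}
    [μ.IsAddHaarMeasure] {D : Set E} {φ η : E → ℝ} (hφ : ContDiff ℝ 1 φ) (hη : ContDiff ℝ 1 η)
    (hηc : HasCompactSupport η) (hηD : tsupport η ⊆ D) (v : E) :
    ∫ x in D, φ x * fderiv ℝ η x v ∂μ = -∫ x in D, fderiv ℝ φ x v * η x ∂μ := by
  have hφ' := (hφ.continuous_fderiv one_ne_zero).clm_apply (continuous_const (y := v))
  have hη' := (hη.continuous_fderiv one_ne_zero).clm_apply (continuous_const (y := v))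
  have hzero : ∀ x ∉ D, η x = 0 := fun x hx =>
    image_eq_zero_of_notMem_tsupport fun h => hx (hηD h)
  have hzero' : ∀ x ∉ D, fderiv ℝ η x v = 0 := fun x hx => by
    rw [fderiv_of_notMem_tsupport ℝ fun h => hx (hηD h), zero_apply]
  rw [setIntegral_eq_integral_of_forall_compl_eq_zero fun x hx => by rw [hzero' x hx, mul_zero],
    setIntegral_eq_integral_of_forall_compl_eq_zero fun x hx => by rw [hzero x hx, mul_zero]]
  exact integral_mul_fderiv_eq_neg_fderiv_mul_of_integrable
    ((hφ'.mul hη.continuous).integrable_of_hasCompactSupport hηc.mul_left)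
    ((hφ.continuous.mul hη').integrable_of_hasCompactSupport (hηc.fderiv_apply ℝ v).mul_left)
    ((hφ.continuous.mul hη.continuous).integrable_of_hasCompactSupport hηc.mul_left)
    (fun x _ => hφ.differentiable one_ne_zero x) (fun x _ => hη.differentiable one_ne_zero x)

variable {d : ℕ} {D : Set (Rd d)}

lemma isWeakGradient_gradient {φ : Rd d → ℝ} (hφ : ContDiff ℝ 1 φ) :
    IsWeakGradient D φ (gradient φ) := fun η hη hηc hηD i => by
  rw [setIntegral_mul_fderiv_eq_neg hφ (hη.of_le (by simp)) hηc hηD]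
  simp only [← inner_gradient_left, EuclideanSpace.inner_single_right, one_mul, conj_trivial]

lemma IsWeakGradient.congr_ae {u u' : Rd d → ℝ} {G G' : Rd d → Rd d}
    (h : IsWeakGradient D u G) (hu : u' =ᵐ[volume.restrict D] u)
    (hG : G' =ᵐ[volume.restrict D] G) : IsWeakGradient D u' G' := fun η hη hηc hηD i => by
  rw [integral_congr_ae (hu.mono fun x hx => by rw [hx]), h η hη hηc hηD i]
  exact congrArg Neg.neg (integral_congr_ae (hG.mono fun x hx => by rw [hx])).symm

lemma isClosed_setOf_isWeakGradient (D : Set (Rd d)) :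
    IsClosed {q : L2 D × L2Vec D | IsWeakGradient D q.1 q.2} := by
  simp only [IsWeakGradient, Set.ofPred_forall]
  refine isClosed_iInter fun η => isClosed_iInter fun hη => isClosed_iInter fun hηc =>
    isClosed_iInter fun _ => isClosed_iInter fun i => ?_
  have hη2 : MemLp η 2 (volume.restrict D) := hη.continuous.memLp_of_hasCompactSupport hηc
  have hη2' : MemLp (fun x => fderiv ℝ η x (EuclideanSpace.single i 1)) 2 (volume.restrict D) :=
    ((hη.continuous_fderiv (by simp)).clm_apply continuous_const).memLp_of_hasCompactSupport
      (hηc.fderiv_apply ℝ _)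
  set coord : L2Vec D →L[ℝ] L2 D := (EuclideanSpace.proj i : Rd d →L[ℝ] ℝ).compLpL 2 _
  have hcoord : ∀ G : L2Vec D, ∫ x in D, G x i * η x = ∫ x in D, coord G x * η x := fun G => by
    refine integral_congr_ae ?_
    filter_upwards [(EuclideanSpace.proj i : Rd d →L[ℝ] ℝ).coeFn_compLpL G] with x hx
    rw [hx]
    rfl
  simp only [hcoord]
  exact isClosed_eq ((continuous_integral_mul hη2').comp continuous_fst)
    ((continuous_integral_mul hη2).comp (coord.continuous.comp continuous_snd)).neg

end WeakGradient

section GraphSpace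

variable {d : ℕ}

/-- The Hilbert space `L²(D) × L²(D; ℝᵈ) × L²(∂D)`, in which a Sobolev function is represented by
the triple of the function, its gradient and its trace. -/
def GraphSpace (D : Set (Rd d)) : Type := WithLp 2 (L2 D × WithLp 2 (L2Vec D × L2Bdry D))

instance (D : Set (Rd d)) : NormedAddCommGroup (GraphSpace D) :=
  inferInstanceAs (NormedAddCommGroup (WithLp 2 (L2 D × WithLp 2 (L2Vec D × L2Bdry D))))

instance (D : Set (Rd d)) : InnerProductSpace ℝ (GraphSpace D) :=
  inferInstanceAs (InnerProductSpace ℝ (WithLp 2 (L2 D × WithLp 2 (L2Vec D × L2Bdry D))))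

instance (D : Set (Rd d)) : CompleteSpace (GraphSpace D) :=
  inferInstanceAs (CompleteSpace (WithLp 2 (L2 D × WithLp 2 (L2Vec D × L2Bdry D))))

namespace GraphSpace

variable {D : Set (Rd d)}

/-- The triple with the given components. -/
def mk (f : L2 D) (G : L2Vec D) (γ : L2Bdry D) : GraphSpace D :=
  WithLp.toLp 2 (f, WithLp.toLp 2 (G, γ))

/-- The function component. -/
def fn : GraphSpace D →L[ℝ] L2 D := WithLp.fstL 2 ℝ _ _

/-- The gradient component. -/
def grad : GraphSpace D →L[ℝ] L2Vec D := (WithLp.fstL 2 ℝ _ _).comp (WithLp.sndL 2 ℝ _ _)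

/-- The trace component. -/
def trace : GraphSpace D →L[ℝ] L2Bdry D := (WithLp.sndL 2 ℝ _ _).comp (WithLp.sndL 2 ℝ _ _)

@[simp] lemma fn_mk (f : L2 D) (G : L2Vec D) (γ : L2Bdry D) : fn (mk f G γ) = f := rfl

@[simp] lemma grad_mk (f : L2 D) (G : L2Vec D) (γ : L2Bdry D) : grad (mk f G γ) = G := rfl

@[simp] lemma trace_mk (f : L2 D) (G : L2Vec D) (γ : L2Bdry D) : trace (mk f G γ) = γ := rfl

lemma mk_fn_grad_trace (p : GraphSpace D) : mk (fn p) (grad p) (trace p) = p := rfl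

lemma continuous_mk : Continuous fun q : L2 D × L2Vec D × L2Bdry D => mk q.1 q.2.1 q.2.2 :=
  (WithLp.prod_continuous_toLp 2 _ _).comp
    (continuous_fst.prodMk ((WithLp.prod_continuous_toLp 2 _ _).comp continuous_snd))

lemma norm_le_add (p : GraphSpace D) : ‖p‖ ≤ ‖fn p‖ + ‖grad p‖ + ‖trace p‖ := by
  have hsq : ‖p‖ ^ 2 = ‖fn p‖ ^ 2 + (‖grad p‖ ^ 2 + ‖trace p‖ ^ 2) :=
    (WithLp.prod_norm_sq_eq_of_L2 _).trans (congrArg _ (WithLp.prod_norm_sq_eq_of_L2 _))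
  refine le_of_sq_le_sq ?_ (by positivity)
  rw [hsq]
  nlinarith [norm_nonneg (fn p), norm_nonneg (grad p), norm_nonneg (trace p),
    mul_nonneg (norm_nonneg (fn p)) (norm_nonneg (grad p)),
    mul_nonneg (norm_nonneg (fn p)) (norm_nonneg (trace p)),
    mul_nonneg (norm_nonneg (grad p)) (norm_nonneg (trace p))]

/-- The triple `p` consists of the smooth function `φ`, its gradient and its restriction to the
boundary. -/
structure Represents (p : GraphSpace D) (φ : Rd d → ℝ) : Prop where
  contDiff : ContDiff ℝ ∞ φ
  fn_ae_eq : fn p =ᵐ[volume.restrict D] φ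
  grad_ae_eq : grad p =ᵐ[volume.restrict D] gradient φ
  trace_ae_eq : trace p =ᵐ[surfaceMeasure D] φ

namespace Represents

variable {p q : GraphSpace D} {φ ψ : Rd d → ℝ}

lemma add (hp : Represents p φ) (hq : Represents q ψ) : Represents (p + q) (φ + ψ) where
  contDiff := hp.contDiff.add hq.contDiff
  fn_ae_eq := by
    rw [map_add]
    exact (Lp.coeFn_add _ _).trans (hp.fn_ae_eq.add hq.fn_ae_eq)
  grad_ae_eq := by
    have hgrad : gradient (φ + ψ) = gradient φ + gradient ψ := funext fun x => by
      simp [gradient, fderiv_add (hp.contDiff.differentiable (by simp) x)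
        (hq.contDiff.differentiable (by simp) x)]
    rw [map_add, hgrad]
    exact (Lp.coeFn_add _ _).trans (hp.grad_ae_eq.add hq.grad_ae_eq)
  trace_ae_eq := by
    rw [map_add]
    exact (Lp.coeFn_add _ _).trans (hp.trace_ae_eq.add hq.trace_ae_eq)

lemma smul (hp : Represents p φ) (c : ℝ) : Represents (c • p) (c • φ) where
  contDiff := hp.contDiff.const_smul c
  fn_ae_eq := by
    rw [map_smul]
    exact (Lp.coeFn_smul _ _).trans (hp.fn_ae_eq.const_smul c)
  grad_ae_eq := by
    have hgrad : gradient (c • φ) = c • gradient φ := funext fun x => by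
      simp [gradient, fderiv_const_smul (hp.contDiff.differentiable (by simp) x)]
    rw [map_smul, hgrad]
    exact (Lp.coeFn_smul _ _).trans (hp.grad_ae_eq.const_smul c)
  trace_ae_eq := by
    rw [map_smul]
    exact (Lp.coeFn_smul _ _).trans (hp.trace_ae_eq.const_smul c)

end Represents

section Const

variable [IsFiniteMeasure (volume.restrict D)] [IsFiniteMeasure (surfaceMeasure D)]

/-- The triple of a constant function. -/
def const (c : ℝ) : GraphSpace D := mk (Lp.const 2 _ c) 0 (Lp.const 2 _ c)

lemma smul_const_one (c : ℝ) : c • (const 1 : GraphSpace D) = const c := by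
  rw [← mk_fn_grad_trace (c • const 1)]
  simp [const, smul_Lp_const_one]

lemma represents_const (c : ℝ) : Represents (const c : GraphSpace D) fun _ => c where
  contDiff := contDiff_const
  fn_ae_eq := Lp.coeFn_const 2 _ c
  grad_ae_eq := by
    have hgrad : gradient (fun _ : Rd d => c) = 0 := funext fun x => gradient_fun_const x c
    rw [hgrad]
    exact Lp.coeFn_zero _ _ _
  trace_ae_eq := Lp.coeFn_const 2 _ c

end Const

end GraphSpace

end GraphSpace

section SobolevGraph

variable {d : ℕ} {D : Set (Rd d)}

lemma tendsto_eLpNorm_sub_iff {X E : Type*} [MeasurableSpace X] {μ : Measure X}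
    [NormedAddCommGroup E] {p : ℝ≥0∞} [Fact (1 ≤ p)] {f : ℕ → Lp E p μ} {φ : ℕ → X → E}
    {g : Lp E p μ} (h : ∀ n, f n =ᵐ[μ] φ n) :
    Tendsto (fun n => eLpNorm (fun x => φ n x - g x) p μ) atTop (𝓝 0) ↔
      Tendsto f atTop (𝓝 g) := by
  rw [Lp.tendsto_Lp_iff_tendsto_eLpNorm']
  exact tendsto_congr fun n => eLpNorm_congr_ae ((h n).symm.sub .rfl)

lemma memLp_of_isBounded {X E : Type*} [PseudoMetricSpace X] [ProperSpace X] [MeasurableSpace X]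
    [BorelSpace X] [NormedAddCommGroup E] {μ : Measure X}
    [IsFiniteMeasure μ] {S : Set X} (hS : Bornology.IsBounded S) (hμ : ∀ᵐ x ∂μ, x ∈ S) {f : X → E}
    (hf : Continuous f) (p : ℝ≥0∞) : MemLp f p μ := by
  obtain ⟨C, hC⟩ := hS.isCompact_closure.exists_bound_of_continuousOn hf.continuousOn
  exact .of_bound hf.aestronglyMeasurable C (hμ.mono fun x hx => hC x (subset_closure hx))

namespace IsLipschitzDomain

lemma isFiniteMeasure_restrict (hD : IsLipschitzDomain D) : IsFiniteMeasure (volume.restrict D) :=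
  ⟨by rw [Measure.restrict_apply_univ]; exact hD.isBounded.measure_lt_top⟩

lemma memLp_restrict (hD : IsLipschitzDomain D) {E : Type*} [NormedAddCommGroup E]
    {f : Rd d → E} (hf : Continuous f) (p : ℝ≥0∞) :
    MemLp f p (volume.restrict D) :=
  have := hD.isFiniteMeasure_restrict
  memLp_of_isBounded hD.isBounded (ae_restrict_mem hD.isOpen.measurableSet) hf p

lemma memLp_surfaceMeasure (hD : IsLipschitzDomain D) {E : Type*} [NormedAddCommGroup E]
    {f : Rd d → E} (hf : Continuous f) (p : ℝ≥0∞) :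
    MemLp f p (surfaceMeasure D) := by
  have := hD.isFiniteMeasure_surfaceMeasure
  have hmem : ∀ᵐ x ∂surfaceMeasure D, x ∈ frontier D :=
    ae_restrict_mem isClosed_frontier.measurableSet
  exact memLp_of_isBounded (hD.isBounded.closure.subset frontier_subset_closure) hmem hf p

end IsLipschitzDomain

namespace GraphSpace

lemma exists_represents (hD : IsLipschitzDomain D) {φ : Rd d → ℝ} (hφ : ContDiff ℝ ∞ φ) :
    ∃ p : GraphSpace D, Represents p φ := by
  have hgrad : Continuous (gradient φ) :=
    (InnerProductSpace.toDual ℝ (Rd d)).symm.continuous.comp (hφ.continuous_fderiv (by simp))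
  have hfn := hD.memLp_restrict hφ.continuous 2
  have hgrad' := hD.memLp_restrict hgrad 2
  have htrace := hD.memLp_surfaceMeasure hφ.continuous 2
  exact ⟨mk (hfn.toLp φ) (hgrad'.toLp _) (htrace.toLp φ),
    hφ, hfn.coeFn_toLp, hgrad'.coeFn_toLp, htrace.coeFn_toLp⟩

end GraphSpace

/-- The triples of functions smooth up to the boundary. -/
def smoothGraph (D : Set (Rd d)) : Submodule ℝ (GraphSpace D) where
  carrier := {p | ∃ φ, GraphSpace.Represents p φ}
  add_mem' := fun ⟨φ, hp⟩ ⟨ψ, hq⟩ => ⟨φ + ψ, hp.add hq⟩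
  zero_mem' := by
    refine ⟨0, contDiff_const, ?_, ?_, ?_⟩
    · rw [map_zero]
      exact Lp.coeFn_zero _ _ _
    · have hgrad : gradient (0 : Rd d → ℝ) = 0 := funext fun x => gradient_const x 0
      rw [map_zero, hgrad]
      exact Lp.coeFn_zero _ _ _
    · rw [map_zero]
      exact Lp.coeFn_zero _ _ _
  smul_mem' := fun c _ ⟨φ, hp⟩ => ⟨c • φ, hp.smul c⟩

/-- The space `H¹(D)`, each function being represented by the triple of itself, its gradient and
its trace. -/
def sobolevGraph (D : Set (Rd d)) : Submodule ℝ (GraphSpace D) := (smoothGraph D).topologicalClosure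

lemma isWeakGradient_of_mem_sobolevGraph {p : GraphSpace D} (hp : p ∈ sobolevGraph D) :
    IsWeakGradient D p.fn p.grad := by
  have hclosed : IsClosed {p : GraphSpace D | IsWeakGradient D p.fn p.grad} :=
    (isClosed_setOf_isWeakGradient D).preimage (f := fun p : GraphSpace D => (p.fn, p.grad))
      (by fun_prop)
  refine closure_minimal (s := (smoothGraph D : Set (GraphSpace D))) ?_ hclosed hp
  rintro p ⟨φ, hφ⟩
  exact (isWeakGradient_gradient (hφ.contDiff.of_le (by simp))).congr_ae
    hφ.fn_ae_eq hφ.grad_ae_eq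

/-- The element of `H¹(D)` represented by a triple. -/
def toH1 (p : sobolevGraph D) : H1 D := ⟨_, _, isWeakGradient_of_mem_sobolevGraph p.2⟩

lemma isTrace_iff (hD : IsLipschitzDomain D) {u : H1 D} {γ : L2Bdry D} :
    IsTrace u γ ↔ GraphSpace.mk u.fn u.grad γ ∈ sobolevGraph D := by
  constructor
  · rintro ⟨φ, hφ, hfn, hgrad, htrace⟩
    choose p hp using fun n => GraphSpace.exists_represents hD (hφ n)
    refine mem_closure_of_tendsto (f := p) (b := atTop) ?_ (.of_forall fun n => ⟨φ n, hp n⟩)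
    have h1 := (tendsto_eLpNorm_sub_iff fun n => (hp n).fn_ae_eq).1 hfn
    have h2 := (tendsto_eLpNorm_sub_iff fun n => (hp n).grad_ae_eq).1 hgrad
    have h3 := (tendsto_eLpNorm_sub_iff fun n => (hp n).trace_ae_eq).1 htrace
    exact (GraphSpace.continuous_mk.tendsto (u.fn, u.grad, γ)).comp
      (h1.prodMk_nhds (h2.prodMk_nhds h3))
  · intro h
    obtain ⟨p, hp, hlim⟩ := mem_closure_iff_seq_limit.1 h
    choose φ hφ using hp
    exact ⟨φ, fun n => (hφ n).contDiff,
      (tendsto_eLpNorm_sub_iff fun n => (hφ n).fn_ae_eq).2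
        ((GraphSpace.fn.continuous.tendsto _).comp hlim),
      (tendsto_eLpNorm_sub_iff fun n => (hφ n).grad_ae_eq).2
        ((GraphSpace.grad.continuous.tendsto _).comp hlim),
      (tendsto_eLpNorm_sub_iff fun n => (hφ n).trace_ae_eq).2
        ((GraphSpace.trace.continuous.tendsto _).comp hlim)⟩

lemma const_mem_sobolevGraph [IsFiniteMeasure (volume.restrict D)]
    [IsFiniteMeasure (surfaceMeasure D)] (c : ℝ) : GraphSpace.const c ∈ sobolevGraph D :=
  (smoothGraph D).le_topologicalClosure ⟨_, GraphSpace.represents_const c⟩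

end SobolevGraph

section MeanZeroGraph

variable {d : ℕ} {D : Set (Rd d)}

lemma enorm_Lp_sub_const {X : Type*} [MeasurableSpace X] {μ : Measure X} [IsFiniteMeasure μ]
    {f : Lp ℝ 2 μ} {φ : X → ℝ} (h : f =ᵐ[μ] φ) (c : ℝ) :
    ‖f - Lp.const 2 μ c‖ₑ = eLpNorm (fun x => φ x - c) 2 μ := by
  rw [Lp.enorm_def]
  exact eLpNorm_congr_ae ((Lp.coeFn_sub _ _).trans (h.sub (Lp.coeFn_const 2 μ c)))

lemma GraphSpace.Represents.enorm_grad_eq {p : GraphSpace D} {φ : Rd d → ℝ} (hp : p.Represents φ) :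
    ‖p.grad‖ₑ = eLpNorm (fderiv ℝ φ) 2 (volume.restrict D) := by
  rw [Lp.enorm_def, eLpNorm_congr_ae hp.grad_ae_eq]
  exact eLpNorm_congr_norm_ae (.of_forall fun x => by
    rw [← toDual_gradient, LinearIsometryEquiv.norm_map])

lemma norm_le_mul_norm_of_enorm_le {E F : Type*} [SeminormedAddGroup E] [SeminormedAddGroup F]
    {x : E} {y : F} {C : ℝ≥0} (h : ‖x‖ₑ ≤ C * ‖y‖ₑ) : ‖x‖ ≤ C * ‖y‖ := by
  simp only [enorm_eq_nnnorm] at h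
  exact_mod_cast h

lemma IsLipschitzDomain.exists_norm_sub_const_le (hD : IsLipschitzDomain D)
    [IsFiniteMeasure (volume.restrict D)] [IsFiniteMeasure (surfaceMeasure D)] :
    ∃ C : ℝ, ∀ p ∈ smoothGraph D, ∃ c : ℝ, ‖p - GraphSpace.const c‖ ≤ C * ‖p.grad‖ := by
  obtain ⟨C, hC⟩ := hD.exists_eLpNorm_sub_const_le (p := 2) ENNReal.ofNat_ne_top
  refine ⟨C + 1 + C, fun p ⟨φ, hp⟩ => ?_⟩
  obtain ⟨c, hfn, htrace⟩ := hC φ (hp.contDiff.of_le (by simp))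
  rw [← hp.enorm_grad_eq, ← enorm_Lp_sub_const hp.fn_ae_eq] at hfn
  rw [← hp.enorm_grad_eq, ← enorm_Lp_sub_const hp.trace_ae_eq] at htrace
  replace hfn := norm_le_mul_norm_of_enorm_le hfn
  replace htrace := norm_le_mul_norm_of_enorm_le htrace
  refine ⟨c, (GraphSpace.norm_le_add _).trans ?_⟩
  simp only [map_sub, GraphSpace.const, GraphSpace.fn_mk, GraphSpace.grad_mk,
    GraphSpace.trace_mk, sub_zero]
  linarith

variable (D) [IsFiniteMeasure (surfaceMeasure D)]

/-- The space `H¹_m(D)` of Sobolev functions with mean-zero trace. -/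
def sobolevMeanZero : Submodule ℝ (GraphSpace D) :=
  sobolevGraph D ⊓ ((integralL2 (surfaceMeasure D)).comp GraphSpace.trace).ker

instance : CompleteSpace (sobolevMeanZero D) :=
  ((smoothGraph D).isClosed_topologicalClosure.inter
    ((integralL2 (surfaceMeasure D)).comp GraphSpace.trace).isClosed_ker).completeSpace_coe

variable {D}

lemma IsLipschitzDomain.exists_norm_le_norm_grad (hD : IsLipschitzDomain D) (hd : d ≠ 0) :
    ∃ C : ℝ, ∀ p ∈ sobolevMeanZero D, ‖p‖ ≤ C * ‖p.grad‖ := by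
  have := hD.isFiniteMeasure_restrict
  obtain ⟨C, hC⟩ := hD.exists_norm_sub_const_le
  have hone : (integralL2 (surfaceMeasure D)).comp GraphSpace.trace
      (GraphSpace.const 1 : GraphSpace D) ≠ 0 := by
    simp only [ContinuousLinearMap.comp_apply, GraphSpace.const, GraphSpace.trace_mk,
      integralL2_const, one_mul]
    rw [measureReal_ne_zero_iff]
    exact hD.surfaceMeasure_ne_zero hd
  obtain ⟨C', hC'⟩ := exists_norm_le_mul_norm_of_mem_closure GraphSpace.grad _ hone
    (S := smoothGraph D) fun p hp => by simpa only [GraphSpace.smul_const_one] using hC p hp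
  exact ⟨C', fun p hp => hC' p hp.1 hp.2⟩

lemma IsLipschitzDomain.exists_sub_const_mem_sobolevMeanZero (hD : IsLipschitzDomain D)
    (hd : d ≠ 0) [IsFiniteMeasure (volume.restrict D)] {p : GraphSpace D}
    (hp : p ∈ sobolevGraph D) : ∃ c : ℝ, p - GraphSpace.const c ∈ sobolevMeanZero D := by
  have hσ : (surfaceMeasure D).real Set.univ ≠ 0 := by
    rw [measureReal_ne_zero_iff]
    exact hD.surfaceMeasure_ne_zero hd
  refine ⟨integralL2 _ p.trace / (surfaceMeasure D).real Set.univ,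
    sub_mem hp (const_mem_sobolevGraph _), LinearMap.mem_ker.2 ?_⟩
  change integralL2 _ (GraphSpace.trace (p - GraphSpace.const _)) = 0
  rw [map_sub, map_sub, GraphSpace.const, GraphSpace.trace_mk, integralL2_const,
    div_mul_cancel₀ _ hσ, sub_self]

end MeanZeroGraph

section Bilin

variable {d : ℕ} (M : Matrix (Fin d) (Fin d) ℝ) (ξ ξ' η η' : Rd d) (c : ℝ)

lemma bilin_add_left : bilin M (ξ + ξ') η = bilin M ξ η + bilin M ξ' η := by
  simp [bilin, add_dotProduct]

lemma bilin_add_right : bilin M ξ (η + η') = bilin M ξ η + bilin M ξ η' := by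
  simp [bilin, Matrix.mulVec_add, dotProduct_add]

lemma bilin_smul_left : bilin M (c • ξ) η = c * bilin M ξ η := by
  simp [bilin, smul_dotProduct]

lemma bilin_smul_right : bilin M ξ (c • η) = c * bilin M ξ η := by
  simp [bilin, Matrix.mulVec_smul, dotProduct_smul]

variable {M} in
lemma bilin_comm (hM : M.IsSymm) : bilin M ξ η = bilin M η ξ := by
  rw [bilin, bilin, Matrix.dotProduct_mulVec, ← Matrix.mulVec_transpose, hM.eq, dotProduct_comm]

variable {M} in
lemma isCoeffField_const {α β : ℝ} (hM : M ∈ coeffSet d α β) (D : Set (Rd d)) :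
    IsCoeffField D α β fun _ => M :=
  ⟨fun _ _ => aemeasurable_const, .of_forall fun _ => hM⟩

end Bilin

section EnergyForm

section L2

variable {X E F : Type*} [MeasurableSpace X] {μ : Measure X} [NormedAddCommGroup E]
  [NormedAddCommGroup F]

lemma integrable_norm_mul_norm (p : Lp E 2 μ) (q : Lp F 2 μ) :
    Integrable (fun x => ‖p x‖ * ‖q x‖) μ :=
  (Lp.memLp p).norm.integrable_mul (Lp.memLp q).norm

lemma integral_norm_mul_norm_le (p : Lp E 2 μ) (q : Lp F 2 μ) :
    ∫ x, ‖p x‖ * ‖q x‖ ∂μ ≤ ‖p‖ * ‖q‖ := by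
  have hp := (Lp.memLp p).norm
  have hq := (Lp.memLp q).norm
  calc ∫ x, ‖p x‖ * ‖q x‖ ∂μ = ⟪hp.toLp _, hq.toLp _⟫_ℝ := by
        rw [inner_eq_integral_mul]
        refine integral_congr_ae ?_
        filter_upwards [hp.coeFn_toLp, hq.coeFn_toLp] with x hpx hqx
        rw [hpx, hqx]
    _ ≤ ‖hp.toLp _‖ * ‖hq.toLp _‖ := real_inner_le_norm _ _
    _ = ‖p‖ * ‖q‖ := by
        rw [Lp.norm_toLp, Lp.norm_toLp, eLpNorm_norm, eLpNorm_norm, Lp.norm_def, Lp.norm_def]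

end L2

variable {d : ℕ} {D : Set (Rd d)} {α β : ℝ} {A : Rd d → Matrix (Fin d) (Fin d) ℝ}

namespace IsCoeffField

lemma aestronglyMeasurable_bilin (hA : IsCoeffField D α β A) {f g : Rd d → Rd d}
    (hf : AEMeasurable f (volume.restrict D)) (hg : AEMeasurable g (volume.restrict D)) :
    AEStronglyMeasurable (fun x => bilin (A x) (f x) (g x)) (volume.restrict D) := by
  have hcoord : ∀ i : Fin d, Measurable fun v : Rd d => v i := fun i => by fun_prop
  refine AEMeasurable.aestronglyMeasurable ?_
  simp only [bilin, dotProduct, Matrix.mulVec]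
  exact Finset.aemeasurable_fun_sum _ fun i _ => ((hcoord i).comp_aemeasurable hf).mul <|
    Finset.aemeasurable_fun_sum _ fun j _ => (hA.1 i j).mul ((hcoord j).comp_aemeasurable hg)

lemma norm_bilin_le (hA : IsCoeffField D α β A) (f g : Rd d → Rd d) :
    ∀ᵐ x ∂volume.restrict D, ‖bilin (A x) (f x) (g x)‖ ≤ |β| * (‖f x‖ * ‖g x‖) := by
  filter_upwards [hA.2] with x hx
  calc ‖bilin (A x) (f x) (g x)‖ ≤ β * ‖f x‖ * ‖g x‖ := hx.2.2 _ _
    _ = β * (‖f x‖ * ‖g x‖) := mul_assoc _ _ _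
    _ ≤ |β| * (‖f x‖ * ‖g x‖) := by gcongr; exact le_abs_self β

lemma integrable_bilin (hA : IsCoeffField D α β A) (p q : L2Vec D) :
    Integrable (fun x => bilin (A x) (p x) (q x)) (volume.restrict D) :=
  ((integrable_norm_mul_norm p q).const_mul |β|).mono'
    (hA.aestronglyMeasurable_bilin (Lp.aestronglyMeasurable p).aemeasurable
      (Lp.aestronglyMeasurable q).aemeasurable) (hA.norm_bilin_le p q)

lemma norm_integral_bilin_le (hA : IsCoeffField D α β A) (p q : L2Vec D) :
    ‖∫ x in D, bilin (A x) (p x) (q x)‖ ≤ |β| * ‖p‖ * ‖q‖ :=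
  calc ‖∫ x in D, bilin (A x) (p x) (q x)‖ ≤ ∫ x in D, |β| * (‖p x‖ * ‖q x‖) :=
        norm_integral_le_of_norm_le ((integrable_norm_mul_norm p q).const_mul |β|)
          (hA.norm_bilin_le p q)
    _ = |β| * ∫ x in D, ‖p x‖ * ‖q x‖ := integral_const_mul _ _
    _ ≤ |β| * (‖p‖ * ‖q‖) := by gcongr; exact integral_norm_mul_norm_le p q
    _ = |β| * ‖p‖ * ‖q‖ := (mul_assoc _ _ _).symm

/-- The bilinear form `(p, q) ↦ ∫_D pᵀ A q` on `L²(D; ℝᵈ)`. -/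
def energyForm (hA : IsCoeffField D α β A) : L2Vec D →L[ℝ] L2Vec D →L[ℝ] ℝ :=
  LinearMap.mkContinuous₂
    (LinearMap.mk₂ ℝ (fun p q : L2Vec D => ∫ x in D, bilin (A x) (p x) (q x))
      (fun p p' q => by
        rw [← integral_add (hA.integrable_bilin p q) (hA.integrable_bilin p' q)]
        refine integral_congr_ae ?_
        filter_upwards [Lp.coeFn_add p p'] with x hx
        rw [hx, Pi.add_apply, bilin_add_left])
      (fun c p q => by
        rw [smul_eq_mul, ← integral_const_mul]
        refine integral_congr_ae ?_
        filter_upwards [Lp.coeFn_smul c p] with x hx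
        rw [hx, Pi.smul_apply, bilin_smul_left])
      (fun p q q' => by
        rw [← integral_add (hA.integrable_bilin p q) (hA.integrable_bilin p q')]
        refine integral_congr_ae ?_
        filter_upwards [Lp.coeFn_add q q'] with x hx
        rw [hx, Pi.add_apply, bilin_add_right])
      (fun c p q => by
        rw [smul_eq_mul, ← integral_const_mul]
        refine integral_congr_ae ?_
        filter_upwards [Lp.coeFn_smul c q] with x hx
        rw [hx, Pi.smul_apply, bilin_smul_right]))
    |β| hA.norm_integral_bilin_le

variable (hA : IsCoeffField D α β A)

lemma energyForm_apply (p q : L2Vec D) :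
    hA.energyForm p q = ∫ x in D, bilin (A x) (p x) (q x) := rfl

lemma energyForm_comm (p q : L2Vec D) : hA.energyForm p q = hA.energyForm q p := by
  rw [energyForm_apply, energyForm_apply]
  refine integral_congr_ae ?_
  filter_upwards [hA.2] with x hx
  exact bilin_comm _ _ hx.1

lemma mul_norm_sq_le_energyForm (p : L2Vec D) : α * ‖p‖ ^ 2 ≤ hA.energyForm p p := by
  rw [energyForm_apply, ← real_inner_self_eq_norm_sq, L2.inner_def, ← integral_const_mul]
  refine integral_mono_ae ((L2.integrable_inner p p).const_mul α) (hA.integrable_bilin p p) ?_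
  filter_upwards [hA.2] with x hx
  rw [real_inner_self_eq_norm_sq]
  exact hx.2.1 _

end IsCoeffField

end EnergyForm

section Neumann

variable {d : ℕ} {D : Set (Rd d)} [IsFiniteMeasure (surfaceMeasure D)]

variable (D) in
/-- The trace operator from `H¹_m(D)` to `L²_m(∂D)`. -/
def traceMeanZero : sobolevMeanZero D →L[ℝ] meanZero (surfaceMeasure D) :=
  (GraphSpace.trace.comp (sobolevMeanZero D).subtypeL).codRestrict _ fun p => p.2.2

@[simp]
lemma coe_traceMeanZero (p : sobolevMeanZero D) :
    (traceMeanZero D p : L2Bdry D) = (p : GraphSpace D).trace := rfl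

/-- The function and the trace encoded by an element of `H¹_m(D)`. -/
def toPair (p : sobolevMeanZero D) : H1 D × L2Bdry D :=
  (toH1 ⟨p, p.2.1⟩, (p : GraphSpace D).trace)

lemma isTrace_toPair (hD : IsLipschitzDomain D) (p : sobolevMeanZero D) :
    IsTrace (toPair p).1 (toPair p).2 :=
  (isTrace_iff hD).2 p.2.1

lemma exists_toPair_eq (hD : IsLipschitzDomain D) {u : H1 D} {γ : L2Bdry D} (hu : IsTrace u γ)
    (hγ : ∫ x, γ x ∂surfaceMeasure D = 0) : ∃ p : sobolevMeanZero D, toPair p = (u, γ) :=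
  ⟨⟨GraphSpace.mk u.fn u.grad γ, (isTrace_iff hD).1 hu, mem_meanZero.2 hγ⟩, rfl⟩

variable {α β : ℝ} {A : Rd d → Matrix (Fin d) (Fin d) ℝ}

/-- The bilinear form `(u, v) ↦ ∫_D ∇uᵀ A ∇v` on `H¹_m(D)`. -/
def dirichletForm (hA : IsCoeffField D α β A) :
    sobolevMeanZero D →L[ℝ] sobolevMeanZero D →L[ℝ] ℝ :=
  hA.energyForm.bilinearComp (GraphSpace.grad.comp (sobolevMeanZero D).subtypeL)
    (GraphSpace.grad.comp (sobolevMeanZero D).subtypeL)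

variable {hA : IsCoeffField D α β A}

lemma dirichletForm_apply (p q : sobolevMeanZero D) :
    dirichletForm hA p q = hA.energyForm (p : GraphSpace D).grad (q : GraphSpace D).grad := rfl

lemma dirichletForm_comm (p q : sobolevMeanZero D) :
    dirichletForm hA p q = dirichletForm hA q p :=
  hA.energyForm_comm _ _

lemma IsLipschitzDomain.isCoercive_dirichletForm (hD : IsLipschitzDomain D) (hd : d ≠ 0)
    (hα : 0 < α) : IsCoercive (dirichletForm hA) := by
  obtain ⟨C, hC⟩ := hD.exists_norm_le_norm_grad hd
  have hC₀ : 0 < |C| + 1 := by positivity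
  refine ⟨α / (|C| + 1) ^ 2, by positivity, fun p => ?_⟩
  have hle : ‖p‖ ≤ (|C| + 1) * ‖(p : GraphSpace D).grad‖ :=
    (hC p p.2).trans (by gcongr; exact (le_abs_self C).trans (le_add_of_nonneg_right zero_le_one))
  calc α / (|C| + 1) ^ 2 * ‖p‖ * ‖p‖ = α * (‖p‖ / (|C| + 1)) ^ 2 := by field_simp
    _ ≤ α * ‖(p : GraphSpace D).grad‖ ^ 2 := by
        gcongr
        exact (div_le_iff₀' hC₀).2 hle
    _ ≤ dirichletForm hA p p := hA.mul_norm_sq_le_energyForm _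

variable (h : IsCoercive (dirichletForm hA))

/-- The Neumann-to-Dirichlet operator `g ↦ u(A, g)|_∂D` on `L²_m(∂D)`. -/
def neumannToDirichlet : meanZero (surfaceMeasure D) →L[ℝ] meanZero (surfaceMeasure D) :=
  (traceMeanZero D).comp (coerciveSolve h (traceMeanZero D))

lemma isSymmetric_neumannToDirichlet :
    (neumannToDirichlet h : meanZero (surfaceMeasure D) →ₗ[ℝ] _).IsSymmetric :=
  isSymmetric_comp_coerciveSolve h _ dirichletForm_comm

lemma isSolution_toPair_iff (hD : IsLipschitzDomain D) (hd : d ≠ 0)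
    {g : meanZero (surfaceMeasure D)} {p : sobolevMeanZero D} :
    IsSolution D A g (toPair p).1 (toPair p).2 ↔ p = coerciveSolve h (traceMeanZero D) g := by
  have := hD.isFiniteMeasure_restrict
  have hinner : ∀ q : sobolevMeanZero D, ⟪g, traceMeanZero D q⟫_ℝ =
      ∫ x, (g : L2Bdry D) x * (q : GraphSpace D).trace x ∂surfaceMeasure D := fun q =>
    inner_eq_integral_mul (g : L2Bdry D) _
  rw [eq_coerciveSolve_iff]
  constructor
  · rintro ⟨-, -, hp⟩ q
    rw [dirichletForm_comm, hinner]
    exact hp _ _ (isTrace_toPair hD q)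
  · refine fun hp => ⟨isTrace_toPair hD p, mem_meanZero.1 p.2.2, fun v τ hv => ?_⟩
    obtain ⟨c, hc⟩ := hD.exists_sub_const_mem_sobolevMeanZero hd ((isTrace_iff hD).1 hv)
    have htest := hp ⟨_, hc⟩
    rw [dirichletForm_comm, dirichletForm_apply, Submodule.coe_inner, coe_traceMeanZero] at htest
    simp only [map_sub, GraphSpace.const, GraphSpace.grad_mk, GraphSpace.trace_mk, sub_zero,
      inner_sub_right, inner_const_eq_zero g.2, inner_eq_integral_mul] at htest
    exact htest

include h in
lemma isWellPosed_of_isCoercive (hD : IsLipschitzDomain D) (hd : d ≠ 0) : IsWellPosed D A := by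
  intro g hg
  lift g to meanZero (surfaceMeasure D) using mem_meanZero.2 hg
  refine ⟨toPair (coerciveSolve h (traceMeanZero D) g), (isSolution_toPair_iff h hD hd).2 rfl, ?_⟩
  rintro ⟨u, γ⟩ hu
  obtain ⟨p, hp⟩ := exists_toPair_eq hD hu.1 hu.2.1
  rw [← hp] at hu ⊢
  rw [(isSolution_toPair_iff h hD hd).1 hu]

lemma solution_eq_toPair (hD : IsLipschitzDomain D) (hd : d ≠ 0)
    (g : meanZero (surfaceMeasure D)) :
    solution D A g = toPair (coerciveSolve h (traceMeanZero D) g) := by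
  have hsol := (isSolution_toPair_iff h hD hd).2 (rfl : coerciveSolve h (traceMeanZero D) g = _)
  exact (isWellPosed_of_isCoercive h hD hd g (mem_meanZero.1 g.2)).unique
    (Classical.epsilon_spec (p := fun p : H1 D × L2Bdry D => IsSolution D A g p.1 p.2) ⟨_, hsol⟩)
    hsol

lemma solution_snd_eq (hD : IsLipschitzDomain D) (hd : d ≠ 0) (g : meanZero (surfaceMeasure D)) :
    (solution D A g).2 = neumannToDirichlet h g := by
  rw [solution_eq_toPair h hD hd]
  rfl

/-- Testing the variational formulation with `u` itself gives `∫ ∇uᵀ A ∇u = ∫ g u`. -/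
lemma energy_eq (hD : IsLipschitzDomain D) (hd : d ≠ 0) (g : meanZero (surfaceMeasure D)) :
    energy D A g = -(1 / 2) * ⟪g, neumannToDirichlet h g⟫_ℝ := by
  have hdata : ∫ x, (g : L2Bdry D) x * (solution D A g).2 x ∂surfaceMeasure D =
      ⟪g, neumannToDirichlet h g⟫_ℝ := by
    rw [solution_snd_eq h hD hd]
    exact (inner_eq_integral_mul _ _).symm
  have hstored : ∫ x in D, bilin (A x) ((solution D A g).1.grad x) ((solution D A g).1.grad x) =
      ⟪g, neumannToDirichlet h g⟫_ℝ := by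
    rw [solution_eq_toPair h hD hd]
    exact (inner_comp_coerciveSolve h (traceMeanZero D) g g).symm
  rw [energy, hdata, hstored]
  ring

end Neumann

section Misfit

variable {d : ℕ} {D : Set (Rd d)} [IsFiniteMeasure (surfaceMeasure D)]

lemma unitData_eq : unitData D =
    Subtype.val '' Metric.sphere (0 : meanZero (surfaceMeasure D)) 1 := by
  ext g
  simp [unitData, L2BdryMean, mem_meanZero, and_comm]

variable {α β α' β' : ℝ} {A B : Rd d → Matrix (Fin d) (Fin d) ℝ} {hA : IsCoeffField D α β A}
  {hB : IsCoeffField D α' β' B} (h : IsCoercive (dirichletForm hA))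
  (h' : IsCoercive (dirichletForm hB)) (hD : IsLipschitzDomain D) (hd : d ≠ 0)
include hD hd

lemma valuesMS_eq : valuesMS D A B =
    (fun g => ‖(neumannToDirichlet h - neumannToDirichlet h') g‖) '' Metric.sphere 0 1 := by
  rw [valuesMS, unitData_eq, Set.image_image]
  refine Set.image_congr fun g _ => ?_
  rw [solution_snd_eq h hD hd, solution_snd_eq h' hD hd]
  rfl

lemma valuesME_eq : valuesME D A B = (fun t => (1 / 2) * t) ''
    ((fun g => |⟪(neumannToDirichlet h - neumannToDirichlet h') g, g⟫_ℝ|) ''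
      Metric.sphere 0 1) := by
  rw [valuesME, unitData_eq, Set.image_image, Set.image_image]
  refine Set.image_congr fun g _ => ?_
  rw [energy_eq h hD hd, energy_eq h' hD hd, ← mul_sub, abs_mul, abs_neg, abs_of_pos one_half_pos,
    ← inner_sub_right, real_inner_comm]
  rfl

include h h' in
lemma bddAbove_valuesMS : BddAbove (valuesMS D A B) := by
  rw [valuesMS_eq h h' hD hd]
  refine ⟨‖neumannToDirichlet h - neumannToDirichlet h'‖, ?_⟩
  rintro _ ⟨g, hg, rfl⟩
  exact ContinuousLinearMap.unit_le_opNorm _ g (mem_sphere_zero_iff_norm.1 hg).le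

include h h' in
lemma bddAbove_valuesME : BddAbove (valuesME D A B) := by
  rw [valuesME_eq h h' hD hd]
  refine (monotone_mul_left_of_nonneg one_half_pos.le).map_bddAbove
    ⟨‖neumannToDirichlet h - neumannToDirichlet h'‖, ?_⟩
  rintro _ ⟨g, hg, rfl⟩
  exact abs_inner_apply_self_le_norm _ (mem_sphere_zero_iff_norm.1 hg)

lemma sSup_valuesMS : sSup (valuesMS D A B) = ‖neumannToDirichlet h - neumannToDirichlet h'‖ := by
  rw [valuesMS_eq h h' hD hd]
  exact ContinuousLinearMap.sSup_sphere_eq_norm _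

lemma sSup_valuesME :
    sSup (valuesME D A B) = (1 / 2) * ‖neumannToDirichlet h - neumannToDirichlet h'‖ := by
  rw [valuesME_eq h h' hD hd, ← sSup_sphere_abs_inner_apply_self_eq_norm
    ((isSymmetric_neumannToDirichlet h).sub (isSymmetric_neumannToDirichlet h'))]
  exact Real.sSup_smul_of_nonneg (one_half_pos (α := ℝ)).le _

end Misfit

end NeumannHom

end

open NeumannHom in
theorem proposition4_general {d : ℕ} (hd : 1 ≤ d) {D : Set (Rd d)}
    (hD : IsLipschitzDomain D) {α β α' β' : ℝ} (hα : 0 < α) (hα' : 0 < α')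
    {A B : Rd d → Matrix (Fin d) (Fin d) ℝ} (hA : IsCoeffField D α β A)
    (hB : IsCoeffField D α' β' B) :
    IsWellPosed D A ∧ IsWellPosed D B ∧
      BddAbove (valuesME D A B) ∧ BddAbove (valuesMS D A B) ∧
      sSup (valuesME D A B) = (1 / 2) * sSup (valuesMS D A B) := by
  have hd₀ : d ≠ 0 := Nat.one_le_iff_ne_zero.1 hd
  have := hD.isFiniteMeasure_surfaceMeasure
  have h : IsCoercive (dirichletForm hA) := hD.isCoercive_dirichletForm hd₀ hα
  have h' : IsCoercive (dirichletForm hB) := hD.isCoercive_dirichletForm hd₀ hα'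
  refine ⟨isWellPosed_of_isCoercive h hD hd₀, isWellPosed_of_isCoercive h' hD hd₀,
    bddAbove_valuesME h h' hD hd₀, bddAbove_valuesMS h h' hD hd₀, ?_⟩
  rw [sSup_valuesME h h' hD hd₀, sSup_valuesMS h h' hD hd₀]

theorem proposition4 {d : ℕ} (hd : 1 ≤ d) (D : Set (NeumannHom.Rd d))
    (hD : NeumannHom.IsLipschitzDomain D) (α β : ℝ) (hα : 0 < α) (hβ : 0 < β)
    (Aeps : ℝ → NeumannHom.Rd d → Matrix (Fin d) (Fin d) ℝ)
    (hAeps : ∀ ε : ℝ, 0 < ε → NeumannHom.IsCoeffField D α β (Aeps ε)) :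
    ∀ ε : ℝ, 0 < ε → ∀ Abar ∈ NeumannHom.coeffSet d α β,
      NeumannHom.IsWellPosed D (Aeps ε) ∧
      NeumannHom.IsWellPosed D (fun _ => Abar) ∧
      BddAbove (NeumannHom.valuesME D (Aeps ε) fun _ => Abar) ∧
      BddAbove (NeumannHom.valuesMS D (Aeps ε) fun _ => Abar) ∧
      NeumannHom.PsiME D (Aeps ε) Abar = (1 / 2) * NeumannHom.PsiMS D (Aeps ε) Abar :=
  fun ε hε _ hAbar => proposition4_general hd hD hα hα (hAeps ε hε)
    (NeumannHom.isCoeffField_const hAbar D)
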